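/- Let $d\in\mathbb N$, let $b\in\mathcal C^\infty(\mathbb R^d,\mathbb R^d)$ be such that all its partial derivatives of every order at least $1$ are bounded, and let $\Sigma$ be a constant real symmetric positive semidefinite $d\times d$ matrix (possibly degenerate). Let $W$ be a standard Brownian motion on $\mathbb R^d$ and consider $$\mathrm dZ_t=b(Z_t)\,\mathrm dt+\Sigma\,\mathrm dW_t .\tag{1}$$ Let $(P_t)_{t\ge 0}$ be the associated Markov semigroup: $P_tf(z)=\mathbb E(f(Z_t)\mid Z_0=z)$ for functions $f$, and $\nu P_t$ is the law of $Z_t$ when $Z_0\sim\nu$ is independent of $W$. Let $M$ be a real symmetric positive definite $d\times d$ matrix and $\rho\in\mathbb R$. Write $\|x\|_M=\sqrt{x\cdot Mx}$, let $J_b(z)=(\partial_{z_j}b_i(z))_{i,j}$, and for square matrices let $A\le B$ mean $x\cdot Ax\le x\cdot Bx$ for all $x$. For $r\in[1,\infty]$ and probability measures $\nu,\mu$ on $\mathbb R^d$ let $$\mathcal W_{M,r}(\nu,\mu)=\inf_{\pi}\big\|(z,y)\mapsto\|z-y\|_M\big\|_{L^r(\pi)}\in[0,\infty],$$ the infimum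 being over all couplings $\pi$ of $\nu$ and $\mu$. For $f:\mathbb R^d\to\mathbb R$ let $$\|\nabla f(z)\|_{M^{-1}}=\lim_{r\downarrow0}\ \sup_{0<\|z-y\|_M\le r}\frac{|f(z)-f(y)|}{\|y-z\|_M},\qquad \|\nabla f\|_{M^{-1},\infty}=\sup_{z\ne y}\frac{|f(z)-f(y)|}{\|y-z\|_M}$$ (suprema over the empty set being $0$), and let $\mathcal C_{b,L}(\mathbb R^d)$ be the set of bounded Lipschitz functions $\mathbb R^d\to\mathbb R$. Then the following are equivalent: (i) $\mathrm{Cont}_R(M,\rho)$: $\;MJ_b(z)\le-\rho M$ for all $z\in\mathbb R^d$. (ii) For all $z_1,z_2\in\mathbb R^d$, if $Z_1,Z_2$ are the solutions of (1) driven by the same Brownian motion $W$ with $Z_{1,0}=z_1$, $Z_{2,0}=z_2$, then almost surely, for all $t\ge0$, $\|Z_{1,t}-Z_{2,t}\|_M\le e^{-\rho t}\|z_1-z_2\|_M$. (iii) For all probability measures $\nu,\mu$ on $\mathbb R^d$ and $t\ge0$, $\mathcal W_{M,\infty}(\nu P_t,\mu P_t)\le e^{-\rho t}\,\mathcal W_{M,\infty}(\nu,\mu)$.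 (iv) For all probability measures $\nu,\mu$ on $\mathbb R^d$ and $t\ge0$, $\mathcal W_{M,1}(\nu P_t,\mu P_t)\le e^{-\rho t}\,\mathcal W_{M,1}(\nu,\mu)$. (v) For all $f\in\mathcal C_{b,L}(\mathbb R^d)$, $t\ge0$ and $z\in\mathbb R^d$, $\|\nabla P_tf(z)\|_{M^{-1}}\le e^{-\rho t}\,P_t\big(\|\nabla f\|_{M^{-1}}\big)(z)$. (vi) For all $f\in\mathcal C_{b,L}(\mathbb R^d)$ and $t\ge0$, $\|\nabla P_tf\|_{M^{-1},\infty}\le e^{-\rho t}\,\|\nabla f\|_{M^{-1},\infty}$. -/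

import Mathlib

open MeasureTheory ProbabilityTheory Matrix
open scoped NNReal ENNReal

noncomputable section

namespace DiffusionContraction

/-- A standard Brownian motion on `ℝ^d`: the coordinates are independent standard real Brownian
motions started at `0` (with almost surely continuous paths). -/
structure IsBrownian {Ω : Type*} [MeasurableSpace Ω] {d : ℕ}
    (W : ℝ≥0 → Ω → EuclideanSpace ℝ (Fin d)) (P : Measure Ω) : Prop where
  coord : ∀ i, IsBrownianReal (fun t ω => W t ω i) P
  indep : iIndepFun (fun (i : Fin d) (ω : Ω) (t : ℝ≥0) => W t ω i) P

/-- The drift is smooth and all its derivatives of order at least one are bounded. -/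
structure IsAdmissibleDrift {d : ℕ} (b : EuclideanSpace ℝ (Fin d) → EuclideanSpace ℝ (Fin d)) :
    Prop where
  smooth : ContDiff ℝ (⊤ : ℕ∞) b
  bounded : ∀ n : ℕ, 1 ≤ n → ∃ C : ℝ, ∀ z, ‖iteratedFDeriv ℝ n b z‖ ≤ C

/-- The continuous path `x` solves `x t = z + ∫₀ᵗ b (x s) ds + S (w t)` for all `t ≥ 0`. -/
def IsPathSolution {d : ℕ} (b : EuclideanSpace ℝ (Fin d) → EuclideanSpace ℝ (Fin d))
    (S : Matrix (Fin d) (Fin d) ℝ) (w : ℝ≥0 → EuclideanSpace ℝ (Fin d))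
    (z : EuclideanSpace ℝ (Fin d)) (x : ℝ≥0 → EuclideanSpace ℝ (Fin d)) : Prop :=
  Continuous x ∧
    ∀ t : ℝ≥0, x t =
      z + (∫ s in (0 : ℝ)..t, b (x s.toNNReal)) + WithLp.toLp 2 (S *ᵥ (w t).ofLp)

/-- `Z` is a solution of `dZ = b(Z) dt + S dW`, `Z 0 = z`. The noise is additive, so the
stochastic equation is an integral equation for almost every path. For a Lipschitz drift its
solution is a deterministic, non-anticipating continuous functional of the path of `W`; adaptedness
is therefore automatic and need not be imposed. -/
def IsSolution {Ω : Type*} [MeasurableSpace Ω] {d : ℕ}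
    (b : EuclideanSpace ℝ (Fin d) → EuclideanSpace ℝ (Fin d))
    (S : Matrix (Fin d) (Fin d) ℝ) (W : ℝ≥0 → Ω → EuclideanSpace ℝ (Fin d)) (P : Measure Ω)
    (z : EuclideanSpace ℝ (Fin d)) (Z : ℝ≥0 → Ω → EuclideanSpace ℝ (Fin d)) : Prop :=
  ∀ᵐ ω ∂P, IsPathSolution b S (fun t => W t ω) z (fun t => Z t ω)

open Classical in
/-- The solution started at `z` (for a Lipschitz drift it exists and is unique along every
continuous path of `W`; the value on the other paths is irrelevant). -/
def solution {Ω : Type*} {d : ℕ} (b : EuclideanSpace ℝ (Fin d) → EuclideanSpace ℝ (Fin d))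
    (S : Matrix (Fin d) (Fin d) ℝ) (W : ℝ≥0 → Ω → EuclideanSpace ℝ (Fin d))
    (z : EuclideanSpace ℝ (Fin d)) (t : ℝ≥0) (ω : Ω) : EuclideanSpace ℝ (Fin d) :=
  if h : ∃ x, IsPathSolution b S (fun t => W t ω) z x then h.choose t else z

/-- The transition probability `δ_z P_t`: the law at time `t` of the solution started at `z`. -/
def transition {Ω : Type*} [MeasurableSpace Ω] {d : ℕ}
    (b : EuclideanSpace ℝ (Fin d) → EuclideanSpace ℝ (Fin d))
    (S : Matrix (Fin d) (Fin d) ℝ) (W : ℝ≥0 → Ω → EuclideanSpace ℝ (Fin d)) (P : Measure Ω)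
    (t : ℝ≥0) (z : EuclideanSpace ℝ (Fin d)) : Measure (EuclideanSpace ℝ (Fin d)) :=
  P.map (solution b S W z t)

/-- The semigroup on functions, `P_t f (z) = E [f (Z_t) | Z_0 = z]`. -/
def semigroup {Ω : Type*} [MeasurableSpace Ω] {d : ℕ}
    (b : EuclideanSpace ℝ (Fin d) → EuclideanSpace ℝ (Fin d))
    (S : Matrix (Fin d) (Fin d) ℝ) (W : ℝ≥0 → Ω → EuclideanSpace ℝ (Fin d)) (P : Measure Ω)
    (t : ℝ≥0) (f : EuclideanSpace ℝ (Fin d) → ℝ) (z : EuclideanSpace ℝ (Fin d)) : ℝ :=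
  ∫ y, f y ∂(transition b S W P t z)

/-- The semigroup acting on `[0, ∞]`-valued functions. -/
def semigroupENN {Ω : Type*} [MeasurableSpace Ω] {d : ℕ}
    (b : EuclideanSpace ℝ (Fin d) → EuclideanSpace ℝ (Fin d))
    (S : Matrix (Fin d) (Fin d) ℝ) (W : ℝ≥0 → Ω → EuclideanSpace ℝ (Fin d)) (P : Measure Ω)
    (t : ℝ≥0) (f : EuclideanSpace ℝ (Fin d) → ℝ≥0∞) (z : EuclideanSpace ℝ (Fin d)) : ℝ≥0∞ :=
  ∫⁻ y, f y ∂(transition b S W P t z)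

/-- The semigroup on measures: `ν P_t` is the mixture `∫ δ_z P_t ν(dz)`. -/
def evolve {Ω : Type*} [MeasurableSpace Ω] {d : ℕ}
    (b : EuclideanSpace ℝ (Fin d) → EuclideanSpace ℝ (Fin d))
    (S : Matrix (Fin d) (Fin d) ℝ) (W : ℝ≥0 → Ω → EuclideanSpace ℝ (Fin d)) (P : Measure Ω)
    (t : ℝ≥0) (ν : Measure (EuclideanSpace ℝ (Fin d))) : Measure (EuclideanSpace ℝ (Fin d)) :=
  ν.bind (transition b S W P t)

/-- The norm `‖x‖_M = √(x · M x)`. -/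
def normM {d : ℕ} (M : Matrix (Fin d) (Fin d) ℝ) (x : EuclideanSpace ℝ (Fin d)) : ℝ :=
  √(x.ofLp ⬝ᵥ M *ᵥ x.ofLp)

/-- `A ≤ B` in the sense of quadratic forms, for not necessarily symmetric matrices. -/
def QuadLE {d : ℕ} (A B : Matrix (Fin d) (Fin d) ℝ) : Prop :=
  ∀ x : Fin d → ℝ, x ⬝ᵥ A *ᵥ x ≤ x ⬝ᵥ B *ᵥ x

/-- The Jacobian matrix `(∂_j b_i (z))_{i j}`. -/
def jacobian {d : ℕ} (b : EuclideanSpace ℝ (Fin d) → EuclideanSpace ℝ (Fin d))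
    (z : EuclideanSpace ℝ (Fin d)) : Matrix (Fin d) (Fin d) ℝ :=
  Matrix.of fun i j => (fderiv ℝ b z (EuclideanSpace.single j 1)) i

/-- The condition `Cont_R(M, ρ)`: `M J_b(z) ≤ -ρ M` for all `z`. -/
def ContR {d : ℕ} (b : EuclideanSpace ℝ (Fin d) → EuclideanSpace ℝ (Fin d))
    (M : Matrix (Fin d) (Fin d) ℝ) (ρ : ℝ) : Prop :=
  ∀ z, QuadLE (M * jacobian b z) (-ρ • M)

/-- The set of couplings (transference plans) of `ν` and `μ`. -/
def couplings {d : ℕ} (ν μ : Measure (EuclideanSpace ℝ (Fin d))) :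
    Set (Measure (EuclideanSpace ℝ (Fin d) × EuclideanSpace ℝ (Fin d))) :=
  {π | π.map Prod.fst = ν ∧ π.map Prod.snd = μ}

/-- The Wasserstein distance `W_{M,r}`, with values in `[0, ∞]`. -/
def wasserstein {d : ℕ} (M : Matrix (Fin d) (Fin d) ℝ) (r : ℝ≥0∞)
    (ν μ : Measure (EuclideanSpace ℝ (Fin d))) : ℝ≥0∞ :=
  ⨅ π ∈ couplings ν μ, eLpNorm (fun p => normM M (p.1 - p.2)) r π

/-- The slope `|f z - f y| / ‖y - z‖_M`. -/
def slopeM {d : ℕ} (M : Matrix (Fin d) (Fin d) ℝ) (f : EuclideanSpace ℝ (Fin d) → ℝ)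
    (z y : EuclideanSpace ℝ (Fin d)) : ℝ≥0∞ :=
  ENNReal.ofReal (|f z - f y| / normM M (y - z))

/-- `‖∇f(z)‖_{M⁻¹}`, the local Lipschitz constant of `f` at `z`: the limit as `r ↓ 0` of the
supremum of the slopes over `0 < ‖z - y‖_M ≤ r`. The supremum is monotone in `r`, so that the limit
is the infimum over `r > 0`. -/
def gradNorm {d : ℕ} (M : Matrix (Fin d) (Fin d) ℝ) (f : EuclideanSpace ℝ (Fin d) → ℝ)
    (z : EuclideanSpace ℝ (Fin d)) : ℝ≥0∞ :=
  ⨅ (r : ℝ) (_ : 0 < r), ⨆ (y : EuclideanSpace ℝ (Fin d))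
    (_ : 0 < normM M (z - y) ∧ normM M (z - y) ≤ r), slopeM M f z y

/-- `‖∇f‖_{M⁻¹,∞}`, the global Lipschitz constant of `f` for `‖·‖_M`. -/
def gradNormSup {d : ℕ} (M : Matrix (Fin d) (Fin d) ℝ) (f : EuclideanSpace ℝ (Fin d) → ℝ) :
    ℝ≥0∞ :=
  ⨆ (z : EuclideanSpace ℝ (Fin d)) (y : EuclideanSpace ℝ (Fin d)) (_ : z ≠ y), slopeM M f z y

/-- Bounded Lipschitz functions. -/
def IsBoundedLipschitz {d : ℕ} (f : EuclideanSpace ℝ (Fin d) → ℝ) : Prop :=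
  (∃ C : ℝ, ∀ z, |f z| ≤ C) ∧ ∃ K : ℝ≥0, LipschitzWith K f

end DiffusionContraction

end

open DiffusionContraction

open DiffusionContraction
open Filter Topology Set
open scoped InnerProductSpace

/-! The noise is additive, so it cancels in the difference of two solutions driven by the same path:
the difference is differentiable in time, with derivative `b (x₁ s) - b (x₂ s)`. With `A` a square
root of `M`, `‖x‖_M` is the Euclidean norm of `A x`, and the condition on the Jacobian integrates
along segments to `⟪A (z - y), A (b z - b y)⟫ ≤ -ρ ‖A (z - y)‖²`. Grönwall applied to the squared
norm then gives pathwise contraction (`IsPathSolution.norm_map_sub_le`), which is (ii).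

From (ii), running a coupling of the initial laws with common noise gives (iii) and (iv)
(`IsFlow.wasserstein_evolve_le`), and comparing slopes of `f` along two nearby solutions gives (v)
(`IsFlow.gradNorm_semigroup_le`). Each of these implies (vi): (v) because local Lipschitz constants
control the global one on a segment, (iii) and (iv) by Kantorovich duality between Dirac masses,
using `W_1 ≤ W_∞`.

To close the cycle, (vi) is tested on truncations of `x ↦ ⟪p, A x⟫`. Removing the truncation bounds
`E ⟪p, A (Z₁ - Z₂)⟫`; for `p = A (z - y)` this bound is an equality at time 0, and its right
derivative there is the one-sided Lipschitz inequality, hence the Jacobian condition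
(`IsFlow.inner_sub_le`, `fderiv_inner_le_of_sub`). -/

namespace DiffusionContraction

/-! ### Integral equations with Lipschitz drift: Picard iteration. -/

section IntegralEquation

variable {E : Type*} [NormedAddCommGroup E] [NormedSpace ℝ E]

/-- The Picard iterates of the integral equation `x t = g t + ∫₀ᵗ b (x s) ds`. -/
noncomputable def picardIter (b : E → E) (g : ℝ≥0 → E) : ℕ → ℝ≥0 → E
  | 0 => g
  | n + 1 => fun t => g t + ∫ s in (0 : ℝ)..t, b (picardIter b g n s.toNNReal)

theorem continuous_integral_toNNReal [CompleteSpace E] {f : ℝ≥0 → E} (hf : Continuous f) :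
    Continuous fun t : ℝ≥0 => ∫ s in (0 : ℝ)..t, f s.toNNReal := by
  have h : Continuous fun t : ℝ => ∫ s in (0 : ℝ)..t, f s.toNNReal :=
    intervalIntegral.continuous_primitive
      (fun a b => (hf.comp continuous_real_toNNReal).intervalIntegrable a b) 0
  exact h.comp NNReal.continuous_coe

theorem continuous_picardIter [CompleteSpace E] {b : E → E} (hb : Continuous b) {g : ℝ≥0 → E}
    (hg : Continuous g) (n : ℕ) : Continuous (picardIter b g n) := by
  induction n with
  | zero => exact hg
  | succ n ih => exact hg.add (continuous_integral_toNNReal (hb.comp ih))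

theorem integral_mul_exp_two_mul (K t : ℝ) :
    ∫ s in (0 : ℝ)..t, K * Real.exp (2 * K * s) = (Real.exp (2 * K * t) - 1) / 2 := by
  have h : ∀ s ∈ uIcc (0 : ℝ) t,
      HasDerivAt (fun s => Real.exp (2 * K * s) / 2) (K * Real.exp (2 * K * s)) s := fun s _ => by
    have := (((hasDerivAt_id s).const_mul (2 * K)).exp).div_const 2
    convert! this using 1
    simp
    ring
  rw [intervalIntegral.integral_eq_sub_of_hasDerivAt h
    ((by fun_prop : Continuous fun s => K * Real.exp (2 * K * s)).intervalIntegrable _ _)]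
  simp
  ring

/-- In the sup norm weighted by `exp (-2Kt)` each Picard step contracts by 1/2, because the integral
of `K exp (2Ks)` over `[0, t]` is at most `exp (2Kt) / 2`. The horizon `T` therefore need not be
small. -/
theorem exists_picardIter_dist_le [CompleteSpace E] {b : E → E} {K : ℝ≥0} (hb : LipschitzWith K b)
    {g : ℝ≥0 → E} (hg : Continuous g) (T : ℝ≥0) :
    ∃ C : ℝ, ∀ n, ∀ t ≤ T,
      dist (picardIter b g n t) (picardIter b g (n + 1) t) ≤ C * (1 / 2) ^ n := by
  have hc := continuous_picardIter hb.continuous hg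
  obtain ⟨C, hC⟩ := (isCompact_Icc (a := (0 : ℝ≥0)) (b := T)).exists_bound_of_continuousOn
    ((hc 1).sub (hc 0)).continuousOn
  have hC0 : 0 ≤ C := (norm_nonneg _).trans (hC 0 ⟨le_rfl, zero_le⟩)
  have key : ∀ n, ∀ t ≤ T, ‖picardIter b g (n + 1) t - picardIter b g n t‖
      ≤ C * (1 / 2) ^ n * Real.exp (2 * K * t) := by
    intro n
    induction n with
    | zero =>
      intro t ht
      have h1 := hC t ⟨zero_le, ht⟩
      have h2 : 1 ≤ Real.exp (2 * K * t) := Real.one_le_exp (by positivity)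
      simpa using h1.trans (le_mul_of_one_le_right hC0 h2)
    | succ n ih =>
      intro t ht
      have hi : ∀ m, IntervalIntegrable (fun s : ℝ => b (picardIter b g m s.toNNReal))
          volume 0 t := fun m =>
        ((hb.continuous.comp (hc m)).comp continuous_real_toNNReal).intervalIntegrable _ _
      have e : picardIter b g (n + 1 + 1) t - picardIter b g (n + 1) t
          = ∫ s in (0 : ℝ)..t, (b (picardIter b g (n + 1) s.toNNReal)
              - b (picardIter b g n s.toNNReal)) := by
        rw [intervalIntegral.integral_sub (hi _) (hi _)]
        simp [picardIter]
      rw [e]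
      have h1 : ‖∫ s in (0 : ℝ)..t, (b (picardIter b g (n + 1) s.toNNReal)
              - b (picardIter b g n s.toNNReal))‖
          ≤ ∫ s in (0 : ℝ)..t, (C * (1 / 2) ^ n) * (K * Real.exp (2 * K * s)) := by
        refine intervalIntegral.norm_integral_le_of_norm_le t.2 (ae_of_all _ fun s hs => ?_)
          ((by fun_prop : Continuous _).intervalIntegrable _ _)
        have hs' : s.toNNReal ≤ T := (Real.toNNReal_le_iff_le_coe.2 hs.2).trans ht
        have := ih _ hs'
        rw [Real.coe_toNNReal _ hs.1.le] at this
        calc _ ≤ K * ‖picardIter b g (n + 1) s.toNNReal - picardIter b g n s.toNNReal‖ :=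
              hb.norm_sub_le _ _
          _ ≤ K * (C * (1 / 2) ^ n * Real.exp (2 * K * s)) := by gcongr
          _ = _ := by ring
      refine h1.trans ?_
      rw [intervalIntegral.integral_const_mul, integral_mul_exp_two_mul, pow_succ]
      have : 0 ≤ C * (1 / 2) ^ n := by positivity
      nlinarith
  refine ⟨C * Real.exp (2 * K * T), fun n t ht => ?_⟩
  rw [dist_comm, dist_eq_norm]
  refine (key n t ht).trans ?_
  have : Real.exp (2 * K * t) ≤ Real.exp (2 * K * T) := by gcongr
  have h0 : 0 ≤ C * (1 / 2) ^ n := by positivity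
  nlinarith

/-- The limit of the Picard iterates. -/
noncomputable def picardLimit [Nonempty E] (b : E → E) (g : ℝ≥0 → E) (t : ℝ≥0) : E :=
  limUnder atTop fun n => picardIter b g n t

theorem tendsto_picardIter [CompleteSpace E] {b : E → E} {K : ℝ≥0} (hb : LipschitzWith K b)
    {g : ℝ≥0 → E} (hg : Continuous g) (t : ℝ≥0) :
    Tendsto (fun n => picardIter b g n t) atTop (𝓝 (picardLimit b g t)) := by
  obtain ⟨C, hC⟩ := exists_picardIter_dist_le hb hg t
  exact (cauchySeq_of_le_geometric (1 / 2) C (by norm_num) fun n => hC n t le_rfl).tendsto_limUnder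

theorem exists_dist_picardLimit_le [CompleteSpace E] {b : E → E} {K : ℝ≥0}
    (hb : LipschitzWith K b) {g : ℝ≥0 → E} (hg : Continuous g) (T : ℝ≥0) :
    ∃ C : ℝ, ∀ n, ∀ t ≤ T,
      dist (picardIter b g n t) (picardLimit b g t) ≤ C * (1 / 2) ^ n := by
  obtain ⟨C, hC⟩ := exists_picardIter_dist_le hb hg T
  refine ⟨C * 2, fun n t ht => ?_⟩
  refine (dist_le_of_le_geometric_of_tendsto (1 / 2) C (by norm_num) (fun n => hC n t ht)
    (tendsto_picardIter hb hg t) n).trans (le_of_eq ?_)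
  ring

theorem continuous_picardLimit [CompleteSpace E] {b : E → E} {K : ℝ≥0} (hb : LipschitzWith K b)
    {g : ℝ≥0 → E} (hg : Continuous g) : Continuous (picardLimit b g) := by
  have h : TendstoLocallyUniformly (picardIter b g) (picardLimit b g) atTop := by
    rw [Metric.tendstoLocallyUniformly_iff]
    intro ε hε t
    obtain ⟨C, hC⟩ := exists_dist_picardLimit_le hb hg (t + 1)
    refine ⟨Iic (t + 1), Iic_mem_nhds (lt_add_one t), ?_⟩
    have hlim : Tendsto (fun n : ℕ => C * (1 / 2 : ℝ) ^ n) atTop (𝓝 0) := by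
      simpa using (tendsto_pow_atTop_nhds_zero_of_lt_one (r := (1 / 2 : ℝ)) (by norm_num)
        (by norm_num)).const_mul C
    filter_upwards [hlim.eventually_lt_const hε] with n hn s hs
    rw [dist_comm]
    exact (hC n s hs).trans_lt hn
  exact h.continuous (Frequently.of_forall fun n => continuous_picardIter hb.continuous hg n)

theorem picardLimit_eq [CompleteSpace E] {b : E → E} {K : ℝ≥0} (hb : LipschitzWith K b)
    {g : ℝ≥0 → E} (hg : Continuous g) (t : ℝ≥0) :
    picardLimit b g t = g t + ∫ s in (0 : ℝ)..t, b (picardLimit b g s.toNNReal) := by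
  obtain ⟨C, hC⟩ := exists_dist_picardLimit_le hb hg t
  have hi : ∀ {f : ℝ≥0 → E}, Continuous f → IntervalIntegrable (fun s : ℝ => b (f s.toNNReal))
      volume 0 t := fun hf =>
    ((hb.continuous.comp hf).comp continuous_real_toNNReal).intervalIntegrable _ _
  refine tendsto_nhds_unique ((tendsto_add_atTop_iff_nat 1).2 (tendsto_picardIter hb hg t)) ?_
  refine Tendsto.const_add _ ?_
  rw [tendsto_iff_norm_sub_tendsto_zero]
  refine squeeze_zero (fun _ => norm_nonneg _) (g := fun n => K * (C * (1 / 2) ^ n) * |(t : ℝ) - 0|)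
    (fun n => ?_) ?_
  · rw [← intervalIntegral.integral_sub (hi (continuous_picardIter hb.continuous hg n))
      (hi (continuous_picardLimit hb hg))]
    refine intervalIntegral.norm_integral_le_of_norm_le_const fun s hs => ?_
    rw [uIoc_of_le t.coe_nonneg] at hs
    refine (hb.norm_sub_le _ _).trans ?_
    rw [← dist_eq_norm]
    have := hC n _ (Real.toNNReal_le_iff_le_coe.2 hs.2)
    gcongr
  · have : Tendsto (fun n : ℕ => (1 / 2 : ℝ) ^ n) atTop (𝓝 0) :=
      tendsto_pow_atTop_nhds_zero_of_lt_one (by norm_num) (by norm_num)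
    simpa using ((this.const_mul C).const_mul (K : ℝ)).mul_const |(t : ℝ) - 0|

theorem hasDerivWithinAt_integral_toNNReal [CompleteSpace E] {f : ℝ≥0 → E} (hf : Continuous f)
    (s : ℝ) : HasDerivWithinAt (fun t : ℝ => ∫ r in (0 : ℝ)..t, f r.toNNReal) (f s.toNNReal)
      (Ici s) s :=
  ((hf.comp continuous_real_toNNReal).integral_hasStrictDerivAt 0 s).hasDerivAt.hasDerivWithinAt

/-- Continuity in time and measurability in `ω` give joint measurability, so the time integral stays
measurable in `ω` and the induction goes through. -/
theorem measurable_picardIter [CompleteSpace E] [MeasurableSpace E] [BorelSpace E]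
    [SecondCountableTopology E] {Ω : Type*} [MeasurableSpace Ω] {b : E → E} (hb : Continuous b)
    {g : Ω → ℝ≥0 → E} (hg : ∀ ω, Continuous (g ω)) (hm : ∀ t, Measurable fun ω => g ω t) (n : ℕ) :
    ∀ t, Measurable fun ω => picardIter b (g ω) n t := by
  induction n with
  | zero => exact hm
  | succ n ih =>
    intro t
    refine (hm t).add ?_
    have h : Measurable fun p : ℝ × Ω => b (picardIter b (g p.2) n p.1.toNNReal) := by
      have := measurable_uncurry_of_continuous_of_measurable
        (u := fun (t : ℝ≥0) ω => picardIter b (g ω) n t)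
        (fun ω => continuous_picardIter hb (hg ω) n) ih
      exact hb.measurable.comp (this.comp
        ((measurable_real_toNNReal.comp measurable_fst).prodMk measurable_snd))
    simp_rw [intervalIntegral.integral_of_le (NNReal.coe_nonneg t)]
    exact (h.stronglyMeasurable.integral_prod_left').measurable

theorem measurable_picardLimit [CompleteSpace E] [MeasurableSpace E] [BorelSpace E]
    [SecondCountableTopology E] {Ω : Type*} [MeasurableSpace Ω] {b : E → E} {K : ℝ≥0}
    (hb : LipschitzWith K b) {g : Ω → ℝ≥0 → E} (hg : ∀ ω, Continuous (g ω))
    (hm : ∀ t, Measurable fun ω => g ω t) (t : ℝ≥0) :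
    Measurable fun ω => picardLimit b (g ω) t :=
  measurable_of_tendsto_metrizable (fun n => measurable_picardIter hb.continuous hg hm n t)
    (tendsto_pi_nhds.2 fun ω => tendsto_picardIter hb (hg ω) t)

end IntegralEquation

theorem IsAdmissibleDrift.exists_lipschitzWith {d : ℕ}
    {b : EuclideanSpace ℝ (Fin d) → EuclideanSpace ℝ (Fin d)} (hb : IsAdmissibleDrift b) :
    ∃ K : ℝ≥0, LipschitzWith K b := by
  obtain ⟨C, hC⟩ := hb.bounded 1 le_rfl
  refine ⟨C.toNNReal, lipschitzWith_of_nnnorm_fderiv_le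
    (hb.smooth.differentiable (by simp)) fun z => ?_⟩
  rw [← NNReal.coe_le_coe, coe_nnnorm, ← norm_iteratedFDeriv_one]
  exact (hC z).trans (Real.le_coe_toNNReal C)

/-! ### The equation along a fixed driving path: differences, uniqueness, existence. -/

section PathSolution

variable {d : ℕ} {b : EuclideanSpace ℝ (Fin d) → EuclideanSpace ℝ (Fin d)}
  {S : Matrix (Fin d) (Fin d) ℝ} {w : ℝ≥0 → EuclideanSpace ℝ (Fin d)}
  {z z₁ z₂ : EuclideanSpace ℝ (Fin d)} {x x₁ x₂ : ℝ≥0 → EuclideanSpace ℝ (Fin d)}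

theorem continuous_toLp_mulVec (S : Matrix (Fin d) (Fin d) ℝ) :
    Continuous fun v : EuclideanSpace ℝ (Fin d) => WithLp.toLp 2 (S *ᵥ v.ofLp) := by
  fun_prop

theorem IsPathSolution.sub_eq (hb : Continuous b) (h₁ : IsPathSolution b S w z₁ x₁)
    (h₂ : IsPathSolution b S w z₂ x₂) (t : ℝ≥0) :
    x₁ t - x₂ t = (z₁ - z₂) + ∫ s in (0 : ℝ)..t, (b (x₁ s.toNNReal) - b (x₂ s.toNNReal)) := by
  have hi : ∀ {x : ℝ≥0 → EuclideanSpace ℝ (Fin d)}, Continuous x →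
      IntervalIntegrable (fun s : ℝ => b (x s.toNNReal)) volume 0 t := fun hx =>
    ((hb.comp hx).comp continuous_real_toNNReal).intervalIntegrable _ _
  rw [h₁.2 t, h₂.2 t, intervalIntegral.integral_sub (hi h₁.1) (hi h₂.1)]
  abel

theorem IsPathSolution.sub_zero (hb : Continuous b) (h₁ : IsPathSolution b S w z₁ x₁)
    (h₂ : IsPathSolution b S w z₂ x₂) : x₁ 0 - x₂ 0 = z₁ - z₂ := by
  simpa using h₁.sub_eq hb h₂ 0

/-- The rough terms `S (w t)` cancel. Only the right derivative is claimed: `toNNReal` freezes the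
paths at negative times, which may break differentiability at 0, and the Grönwall arguments need no
more. -/
theorem IsPathSolution.hasDerivWithinAt_sub (hb : Continuous b)
    (h₁ : IsPathSolution b S w z₁ x₁) (h₂ : IsPathSolution b S w z₂ x₂) {s : ℝ} (hs : 0 ≤ s) :
    HasDerivWithinAt (fun s : ℝ => x₁ s.toNNReal - x₂ s.toNNReal)
      (b (x₁ s.toNNReal) - b (x₂ s.toNNReal)) (Ici s) s := by
  have h := (hasDerivWithinAt_integral_toNNReal
    (f := fun s => b (x₁ s) - b (x₂ s)) ((hb.comp h₁.1).sub (hb.comp h₂.1)) s).const_add (z₁ - z₂)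
  have e : ∀ r ∈ Ici s, x₁ r.toNNReal - x₂ r.toNNReal
      = z₁ - z₂ + ∫ s in (0 : ℝ)..r, (b (x₁ s.toNNReal) - b (x₂ s.toNNReal)) := fun r hr => by
    rw [h₁.sub_eq hb h₂, Real.coe_toNNReal _ (hs.trans hr)]
  exact h.congr e (e s self_mem_Ici)

theorem IsPathSolution.continuous_sub (h₁ : IsPathSolution b S w z₁ x₁)
    (h₂ : IsPathSolution b S w z₂ x₂) :
    Continuous fun s : ℝ => x₁ s.toNNReal - x₂ s.toNNReal :=
  (h₁.1.comp continuous_real_toNNReal).sub (h₂.1.comp continuous_real_toNNReal)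

theorem IsPathSolution.norm_sub_le {K : ℝ≥0} (hb : LipschitzWith K b)
    (h₁ : IsPathSolution b S w z₁ x₁) (h₂ : IsPathSolution b S w z₂ x₂) (t : ℝ≥0) :
    ‖x₁ t - x₂ t‖ ≤ Real.exp (K * t) * ‖z₁ - z₂‖ := by
  have h := norm_le_gronwallBound_of_norm_deriv_right_le (K := K) (ε := 0) (δ := ‖z₁ - z₂‖)
    (a := 0) (b := t) (h₁.continuous_sub h₂).continuousOn
    (fun s hs => h₁.hasDerivWithinAt_sub hb.continuous h₂ hs.1)
    (by simpa using (congrArg norm (h₁.sub_zero hb.continuous h₂)).le)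
    (fun s _ => by simpa using hb.norm_sub_le _ _) t ⟨t.2, le_rfl⟩
  rw [gronwallBound_ε0] at h
  simpa [mul_comm] using h

theorem IsPathSolution.eq {K : ℝ≥0} (hb : LipschitzWith K b)
    (h₁ : IsPathSolution b S w z x₁) (h₂ : IsPathSolution b S w z x₂) : x₁ = x₂ := by
  funext t
  simpa [sub_eq_zero] using h₁.norm_sub_le hb h₂ t

/-- The solution of the integral equation along a continuous path. -/
noncomputable def pathFlow (b : EuclideanSpace ℝ (Fin d) → EuclideanSpace ℝ (Fin d))
    (S : Matrix (Fin d) (Fin d) ℝ) (w : ℝ≥0 → EuclideanSpace ℝ (Fin d))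
    (z : EuclideanSpace ℝ (Fin d)) : ℝ≥0 → EuclideanSpace ℝ (Fin d) :=
  picardLimit b fun t => z + WithLp.toLp 2 (S *ᵥ (w t).ofLp)

theorem isPathSolution_pathFlow {K : ℝ≥0} (hb : LipschitzWith K b) (hw : Continuous w)
    (z : EuclideanSpace ℝ (Fin d)) : IsPathSolution b S w z (pathFlow b S w z) := by
  have hg : Continuous fun t => z + WithLp.toLp 2 (S *ᵥ (w t).ofLp) :=
    continuous_const.add ((continuous_toLp_mulVec S).comp hw)
  refine ⟨continuous_picardLimit hb hg, fun t => ?_⟩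
  have := picardLimit_eq hb hg t
  simp only [pathFlow] at this ⊢
  rw [this]
  abel

end PathSolution

/-! ### Continuous measurable versions of Brownian motion. -/

/-- The path of a process with almost surely continuous paths agrees almost surely with that of a
process all of whose paths are continuous and all of whose marginals are measurable. -/
theorem exists_continuous_measurable_version {Ω E : Type*} [MeasurableSpace Ω] {P : Measure Ω}
    [TopologicalSpace E] [TopologicalSpace.PseudoMetrizableSpace E] [Zero E] [MeasurableSpace E] [BorelSpace E]
    {W : ℝ≥0 → Ω → E} (hm : ∀ t, AEMeasurable (W t) P)
    (hc : ∀ᵐ ω ∂P, Continuous fun t => W t ω) (h0 : ∀ᵐ ω ∂P, W 0 ω = 0) :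
    ∃ V : ℝ≥0 → Ω → E, (∀ t, Measurable (V t)) ∧ (∀ ω, Continuous fun t => V t ω) ∧
      (∀ ω, V 0 ω = 0) ∧ ∀ᵐ ω ∂P, ∀ t, W t ω = V t ω := by
  classical
  obtain ⟨D, hDc, hDd⟩ := TopologicalSpace.exists_countable_dense ℝ≥0
  have hq : ∀ᵐ ω ∂P, ∀ q ∈ D, W q ω = (hm q).mk (W q) ω :=
    (ae_ball_iff hDc).2 fun q _ => (hm q).ae_eq_mk
  obtain ⟨G, hG, hGm, hGs⟩ : ∃ G : Set Ω, G ∈ ae P ∧ MeasurableSet G ∧ G ⊆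
      {ω | (Continuous fun t => W t ω) ∧ W 0 ω = 0 ∧ ∀ q ∈ D, W q ω = (hm q).mk (W q) ω} := by
    have : ∀ᵐ ω ∂P, (Continuous fun t => W t ω) ∧ W 0 ω = 0 ∧
        ∀ q ∈ D, W q ω = (hm q).mk (W q) ω := by
      filter_upwards [hc, h0, hq] with ω h1 h2 h3 using ⟨h1, h2, h3⟩
    obtain ⟨G, h1, h2, h3⟩ := (Filter.Eventually.exists_measurable_mem this)
    exact ⟨G, h1, h2, fun ω hω => h3 ω hω⟩
  -- The process is set to 0 off the good event `G`. Its marginals are measurable at times in the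
  -- dense set `D`, hence at all times as limits along continuous paths.
  refine ⟨fun t => G.indicator (W t), fun t => ?_, fun ω => ?_, fun ω => ?_, ?_⟩
  · obtain ⟨u, hu, hut⟩ := mem_closure_iff_seq_limit.1 (hDd t)
    have hmk : ∀ q ∈ D, Measurable (G.indicator (W q)) := fun q hqD => by
      have : G.indicator (W q) = G.indicator ((hm q).mk (W q)) := by
        apply indicator_congr
        exact fun ω hω => (hGs hω).2.2 q hqD
      rw [this]
      exact (hm q).measurable_mk.indicator hGm
    refine measurable_of_tendsto_metrizable (fun n => hmk (u n) (hu n)) (tendsto_pi_nhds.2 ?_)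
    intro ω
    by_cases hω : ω ∈ G
    · simp only [indicator_of_mem hω]
      exact ((hGs hω).1.tendsto t).comp hut
    · simp only [indicator_of_notMem hω]
      exact tendsto_const_nhds
  · by_cases hω : ω ∈ G
    · simp only [indicator_of_mem hω]
      exact (hGs hω).1
    · simp only [indicator_of_notMem hω]
      exact continuous_const
  · by_cases hω : ω ∈ G
    · simp only [indicator_of_mem hω, (hGs hω).2.1]
    · simp only [indicator_of_notMem hω]
  · filter_upwards [hG] with ω hω t
    rw [indicator_of_mem hω]

theorem IsBrownian.exists_continuous_version {Ω : Type*} [MeasurableSpace Ω] {P : Measure Ω}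
    {d : ℕ} {W : ℝ≥0 → Ω → EuclideanSpace ℝ (Fin d)} (hW : IsBrownian W P) :
    ∃ V : ℝ≥0 → Ω → EuclideanSpace ℝ (Fin d), (∀ t, Measurable (V t)) ∧
      (∀ ω, Continuous fun t => V t ω) ∧ (∀ ω, V 0 ω = 0) ∧ ∀ᵐ ω ∂P, ∀ t, W t ω = V t ω := by
  refine exists_continuous_measurable_version (fun t => ?_) ?_ ?_
  · have : AEMeasurable (fun ω i => W t ω i) P :=
      aemeasurable_pi_lambda _ fun i => (hW.coord i).toIsPreBrownianReal.aemeasurable t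
    exact (WithLp.measurable_toLp 2 _).comp_aemeasurable this
  · filter_upwards [ae_all_iff.2 fun i => (hW.coord i).cont] with ω hω
    exact (PiLp.continuous_toLp 2 _).comp (continuous_pi hω)
  · filter_upwards [ae_all_iff.2 fun i => (hW.coord i).toIsPreBrownianReal.eval_zero_ae_eq_zero]
      with ω hω
    ext i
    simpa using hω i

/-! ### The stochastic flow and the semigroup it represents. -/

section Flow

variable {Ω : Type*} [MeasurableSpace Ω] {P : Measure Ω} {d : ℕ}

/-- A measurable version of the stochastic flow: along every path of a continuous process `V`
that starts at `0` and agrees almost surely with `W`, it solves the integral equation. -/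
structure IsFlow (b : EuclideanSpace ℝ (Fin d) → EuclideanSpace ℝ (Fin d))
    (S : Matrix (Fin d) (Fin d) ℝ) (W : ℝ≥0 → Ω → EuclideanSpace ℝ (Fin d)) (P : Measure Ω)
    (Φ : EuclideanSpace ℝ (Fin d) → ℝ≥0 → Ω → EuclideanSpace ℝ (Fin d)) : Prop where
  measurable : ∀ z t, Measurable (Φ z t)
  isPathSolution : ∃ V : ℝ≥0 → Ω → EuclideanSpace ℝ (Fin d), (∀ ω, V 0 ω = 0) ∧
    ∀ z ω, IsPathSolution b S (fun t => V t ω) z (fun t => Φ z t ω)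
  isSolution : ∀ z, IsSolution b S W P z (Φ z)

variable {b : EuclideanSpace ℝ (Fin d) → EuclideanSpace ℝ (Fin d)}
  {S : Matrix (Fin d) (Fin d) ℝ} {W : ℝ≥0 → Ω → EuclideanSpace ℝ (Fin d)}
  {Φ : EuclideanSpace ℝ (Fin d) → ℝ≥0 → Ω → EuclideanSpace ℝ (Fin d)} {K : ℝ≥0}

/-- Solving along the everywhere continuous version `V` gives a solution for every `ω`, so no
exceptional set depends on the starting point. -/
theorem exists_isFlow (hW : IsBrownian W P) (hb : LipschitzWith K b) : ∃ Φ, IsFlow b S W P Φ := by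
  obtain ⟨V, hVm, hVc, hV0, hVW⟩ := hW.exists_continuous_version
  have hsol : ∀ z ω, IsPathSolution b S (fun t => V t ω) z
      (fun t => pathFlow b S (fun t => V t ω) z t) := fun z ω =>
    isPathSolution_pathFlow hb (hVc ω) z
  refine ⟨fun z t ω => pathFlow b S (fun t => V t ω) z t, fun z t => ?_, ⟨V, hV0, hsol⟩,
    fun z => ?_⟩
  · exact measurable_picardLimit hb
      (fun ω => continuous_const.add ((continuous_toLp_mulVec S).comp (hVc ω)))
      (fun t => ((continuous_toLp_mulVec S).measurable.comp (hVm t)).const_add z) t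
  · filter_upwards [hVW] with ω hω
    simpa only [hω] using hsol z ω

theorem IsFlow.norm_sub_le (hΦ : IsFlow b S W P Φ) (hb : LipschitzWith K b)
    (z y : EuclideanSpace ℝ (Fin d)) (t : ℝ≥0) (ω : Ω) :
    ‖Φ z t ω - Φ y t ω‖ ≤ Real.exp (K * t) * ‖z - y‖ := by
  obtain ⟨V, -, h⟩ := hΦ.isPathSolution
  exact (h z ω).norm_sub_le hb (h y ω) t

theorem IsFlow.zero (hΦ : IsFlow b S W P Φ) (z : EuclideanSpace ℝ (Fin d)) (ω : Ω) :
    Φ z 0 ω = z := by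
  obtain ⟨V, h0, h⟩ := hΦ.isPathSolution
  simpa [h0] using (h z ω).2 0

theorem IsFlow.continuous (hΦ : IsFlow b S W P Φ) (hb : LipschitzWith K b) (t : ℝ≥0) (ω : Ω) :
    Continuous fun z => Φ z t ω :=
  (LipschitzWith.of_dist_le_mul (K := (Real.exp (K * t)).toNNReal) fun z y => by
    rw [dist_eq_norm, dist_eq_norm, Real.coe_toNNReal _ (Real.exp_nonneg _)]
    exact hΦ.norm_sub_le hb z y t ω).continuous

theorem IsFlow.measurable_uncurry (hΦ : IsFlow b S W P Φ) (hb : LipschitzWith K b) (t : ℝ≥0) :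
    Measurable fun p : EuclideanSpace ℝ (Fin d) × Ω => Φ p.1 t p.2 :=
  measurable_uncurry_of_continuous_of_measurable (u := fun z ω => Φ z t ω)
    (fun ω => hΦ.continuous hb t ω) fun z => hΦ.measurable z t

/-- Pathwise uniqueness identifies the solution picked by choice with the measurable flow, so laws
may be computed with `Φ`. -/
theorem IsFlow.solution_ae_eq (hΦ : IsFlow b S W P Φ) (hb : LipschitzWith K b)
    (z : EuclideanSpace ℝ (Fin d)) : ∀ᵐ ω ∂P, ∀ t, solution b S W z t ω = Φ z t ω := by
  filter_upwards [hΦ.isSolution z] with ω hω t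
  have hex : ∃ x, IsPathSolution b S (fun t => W t ω) z x := ⟨_, hω⟩
  rw [solution, dif_pos hex]
  exact congrFun (hex.choose_spec.eq hb hω) t

theorem IsFlow.transition_eq (hΦ : IsFlow b S W P Φ) (hb : LipschitzWith K b) (t : ℝ≥0)
    (z : EuclideanSpace ℝ (Fin d)) : transition b S W P t z = P.map (Φ z t) :=
  Measure.map_congr ((hΦ.solution_ae_eq hb z).mono fun _ h => h t)

/-- This makes the transition probabilities a kernel, as the formulas for `Measure.bind` in `evolve`
require. -/
theorem IsFlow.measurable_transition [SFinite P] (hΦ : IsFlow b S W P Φ) (hb : LipschitzWith K b)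
    (t : ℝ≥0) : Measurable (transition b S W P t) := by
  refine Measure.measurable_of_measurable_coe _ fun s hs => ?_
  simp_rw [hΦ.transition_eq hb t, Measure.map_apply (hΦ.measurable _ t) hs]
  exact measurable_measure_prodMk_left (hΦ.measurable_uncurry hb t hs)

theorem IsFlow.isProbabilityMeasure_transition [IsProbabilityMeasure P] (hΦ : IsFlow b S W P Φ)
    (hb : LipschitzWith K b) (t : ℝ≥0) (z : EuclideanSpace ℝ (Fin d)) :
    IsProbabilityMeasure (transition b S W P t z) := by
  rw [hΦ.transition_eq hb]
  exact Measure.isProbabilityMeasure_map (hΦ.measurable z t).aemeasurable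

theorem IsFlow.semigroup_eq (hΦ : IsFlow b S W P Φ) (hb : LipschitzWith K b) (t : ℝ≥0)
    {f : EuclideanSpace ℝ (Fin d) → ℝ} (hf : Continuous f) (z : EuclideanSpace ℝ (Fin d)) :
    semigroup b S W P t f z = ∫ ω, f (Φ z t ω) ∂P := by
  rw [semigroup, hΦ.transition_eq hb,
    integral_map (hΦ.measurable z t).aemeasurable hf.aestronglyMeasurable]

theorem IsFlow.semigroupENN_eq (hΦ : IsFlow b S W P Φ) (hb : LipschitzWith K b) (t : ℝ≥0)
    {f : EuclideanSpace ℝ (Fin d) → ℝ≥0∞} (hf : Measurable f) (z : EuclideanSpace ℝ (Fin d)) :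
    semigroupENN b S W P t f z = ∫⁻ ω, f (Φ z t ω) ∂P := by
  rw [semigroupENN, hΦ.transition_eq hb, lintegral_map hf (hΦ.measurable z t)]

end Flow

/-! ### The square root of `M` and the one-sided Lipschitz condition. -/

section

variable {d : ℕ} {M : Matrix (Fin d) (Fin d) ℝ}
  {A : EuclideanSpace ℝ (Fin d) →L[ℝ] EuclideanSpace ℝ (Fin d)}

/-- `A` is a square root of `M`: the form `x · M y` is the inner product of `A x` and `A y`. -/
structure IsRoot (M : Matrix (Fin d) (Fin d) ℝ)
    (A : EuclideanSpace ℝ (Fin d) →L[ℝ] EuclideanSpace ℝ (Fin d)) : Prop where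
  inner_eq : ∀ x y : EuclideanSpace ℝ (Fin d), x.ofLp ⬝ᵥ M *ᵥ y.ofLp = ⟪A x, A y⟫_ℝ
  injective : Function.Injective A

theorem exists_isRoot (hM : M.PosDef) : ∃ A, IsRoot M A := by
  obtain ⟨N, hN⟩ : ∃ N : Matrix (Fin d) (Fin d) ℝ, M = Nᴴ * N := by
    open scoped MatrixOrder in
    exact CStarAlgebra.nonneg_iff_eq_star_mul_self.1 hM.posSemidef.nonneg
  have h : ∀ x y : EuclideanSpace ℝ (Fin d), x.ofLp ⬝ᵥ M *ᵥ y.ofLp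
      = ⟪(Matrix.toEuclideanCLM (𝕜 := ℝ) N) x, (Matrix.toEuclideanCLM (𝕜 := ℝ) N) y⟫_ℝ := by
    intro x y
    rw [EuclideanSpace.inner_eq_star_dotProduct, hN]
    simp only [Matrix.ofLp_toEuclideanCLM, star_trivial]
    rw [← Matrix.mulVec_mulVec, Matrix.dotProduct_mulVec, conjTranspose_eq_transpose_of_trivial,
      Matrix.vecMul_transpose, dotProduct_comm]
  refine ⟨Matrix.toEuclideanCLM (𝕜 := ℝ) N, h, ?_⟩
  rw [injective_iff_map_eq_zero]
  intro x hx
  by_contra hne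
  have := hM.dotProduct_mulVec_pos (x := x.ofLp) (by simpa using hne)
  rw [star_trivial, h x x, hx, inner_zero_left] at this
  exact this.false

theorem IsRoot.normM_eq (hA : IsRoot M A) (x : EuclideanSpace ℝ (Fin d)) : normM M x = ‖A x‖ := by
  rw [normM, hA.inner_eq, real_inner_self_eq_norm_sq, Real.sqrt_sq (norm_nonneg _)]

theorem IsRoot.norm_pos_iff (hA : IsRoot M A) {x : EuclideanSpace ℝ (Fin d)} :
    0 < ‖A x‖ ↔ x ≠ 0 := by
  rw [_root_.norm_pos_iff, Ne, map_eq_zero_iff A hA.injective]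

theorem IsRoot.exists_norm_le (hA : IsRoot M A) : ∃ c : ℝ, 0 < c ∧ ∀ x, ‖x‖ ≤ c * ‖A x‖ := by
  obtain ⟨c, hc, h⟩ := A.toLinearMap.exists_antilipschitzWith
    (LinearMap.ker_eq_bot.2 hA.injective)
  exact ⟨c, hc, fun x => by simpa using h.le_mul_dist x 0⟩

theorem jacobian_mulVec (b : EuclideanSpace ℝ (Fin d) → EuclideanSpace ℝ (Fin d))
    (z x : EuclideanSpace ℝ (Fin d)) : jacobian b z *ᵥ x.ofLp = (fderiv ℝ b z x).ofLp := by
  have hx : x = ∑ j, x j • EuclideanSpace.single j (1 : ℝ) := by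
    ext i
    simp [Finset.sum_apply, Pi.single_apply]
  ext i
  conv_rhs => rw [hx, map_sum]
  simp [jacobian, Matrix.mulVec, dotProduct, mul_comm]

theorem IsRoot.contR_iff (hA : IsRoot M A)
    {b : EuclideanSpace ℝ (Fin d) → EuclideanSpace ℝ (Fin d)} {ρ : ℝ} :
    ContR b M ρ ↔ ∀ z x, ⟪A x, A (fderiv ℝ b z x)⟫_ℝ ≤ -ρ * ‖A x‖ ^ 2 := by
  have e : ∀ z x : EuclideanSpace ℝ (Fin d),
      (x.ofLp ⬝ᵥ (M * jacobian b z) *ᵥ x.ofLp ≤ x.ofLp ⬝ᵥ (-ρ • M) *ᵥ x.ofLp) ↔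
        ⟪A x, A (fderiv ℝ b z x)⟫_ℝ ≤ -ρ * ‖A x‖ ^ 2 := fun z x => by
    rw [← Matrix.mulVec_mulVec, jacobian_mulVec, hA.inner_eq, Matrix.smul_mulVec,
      dotProduct_smul, hA.inner_eq, real_inner_self_eq_norm_sq, smul_eq_mul]
  exact ⟨fun h z x => (e z x).1 (h z x.ofLp),
    fun h z x => (e z (WithLp.toLp 2 x)).2 (h z (WithLp.toLp 2 x))⟩

/-- The differential one-sided Lipschitz condition in integrated form. -/
theorem inner_sub_le_of_fderiv {b : EuclideanSpace ℝ (Fin d) → EuclideanSpace ℝ (Fin d)}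
    (hb : Differentiable ℝ b) {ρ : ℝ}
    (h : ∀ z x, ⟪A x, A (fderiv ℝ b z x)⟫_ℝ ≤ -ρ * ‖A x‖ ^ 2) (z y : EuclideanSpace ℝ (Fin d)) :
    ⟪A (z - y), A (b z - b y)⟫_ℝ ≤ -ρ * ‖A (z - y)‖ ^ 2 := by
  have hd : ∀ θ : ℝ, HasDerivAt (fun θ : ℝ => ⟪A (z - y), A (b (y + θ • (z - y)))⟫_ℝ)
      ⟪A (z - y), A (fderiv ℝ b (y + θ • (z - y)) (z - y))⟫_ℝ θ := fun θ => by
    have h1 : HasDerivAt (fun θ : ℝ => y + θ • (z - y)) (z - y) θ := by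
      simpa using ((hasDerivAt_id θ).smul_const (z - y)).const_add y
    exact (innerSL ℝ (A (z - y))).hasFDerivAt.comp_hasDerivAt θ
      (A.hasFDerivAt.comp_hasDerivAt θ ((hb _).hasFDerivAt.comp_hasDerivAt θ h1))
  have := image_sub_le_mul_sub_of_deriv_le (fun θ => (hd θ).differentiableAt)
    (fun θ => by rw [(hd θ).deriv]; exact h _ _) (zero_le_one (α := ℝ))
  simpa [← inner_sub_right, ← map_sub] using this

/-- The one-sided Lipschitz condition contracts solutions driven by the same path. -/
theorem IsPathSolution.norm_map_sub_le {b : EuclideanSpace ℝ (Fin d) → EuclideanSpace ℝ (Fin d)}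
    {S : Matrix (Fin d) (Fin d) ℝ} {w x₁ x₂ : ℝ≥0 → EuclideanSpace ℝ (Fin d)}
    {z₁ z₂ : EuclideanSpace ℝ (Fin d)} (hb : Continuous b) {ρ : ℝ}
    (h : ∀ z y, ⟪A (z - y), A (b z - b y)⟫_ℝ ≤ -ρ * ‖A (z - y)‖ ^ 2)
    (h₁ : IsPathSolution b S w z₁ x₁) (h₂ : IsPathSolution b S w z₂ x₂) (t : ℝ≥0) :
    ‖A (x₁ t - x₂ t)‖ ≤ Real.exp (-ρ * t) * ‖A (z₁ - z₂)‖ := by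
  have hd : ∀ s : ℝ, 0 ≤ s → HasDerivWithinAt
      (fun s : ℝ => ‖A (x₁ s.toNNReal - x₂ s.toNNReal)‖ ^ 2)
      (2 * ⟪A (x₁ s.toNNReal - x₂ s.toNNReal), A (b (x₁ s.toNNReal) - b (x₂ s.toNNReal))⟫_ℝ)
      (Ici s) s := fun s hs =>
    (A.hasFDerivAt.comp_hasDerivWithinAt s (h₁.hasDerivWithinAt_sub hb h₂ hs)).norm_sq
  -- Squaring avoids differentiating the norm at 0. The rate `-2 * ρ` may have either sign.
  have key := le_gronwallBound_of_liminf_deriv_right_le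
    (f := fun s : ℝ => ‖A (x₁ s.toNNReal - x₂ s.toNNReal)‖ ^ 2)
    (δ := ‖A (z₁ - z₂)‖ ^ 2) (K := -2 * ρ) (ε := 0) (a := 0) (b := t)
    ((A.continuous.comp (h₁.continuous_sub h₂)).norm.pow 2).continuousOn
    (fun s hs r hr => (hd s hs.1).liminf_right_slope_le hr)
    (by simp [-map_sub, h₁.sub_zero hb h₂])
    (fun s _ => by
      have := h (x₁ s.toNNReal) (x₂ s.toNNReal)
      linarith) t ⟨t.2, le_rfl⟩
  rw [gronwallBound_ε0] at key
  simp only [Real.toNNReal_coe] at key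
  refine le_of_sq_le_sq ?_ (by positivity)
  refine key.trans (le_of_eq ?_)
  rw [mul_pow, ← Real.exp_nat_mul, mul_comm]
  congr 2
  push_cast
  ring

end

section

variable {d : ℕ} {M : Matrix (Fin d) (Fin d) ℝ}
  {A : EuclideanSpace ℝ (Fin d) →L[ℝ] EuclideanSpace ℝ (Fin d)}

theorem continuous_normM (M : Matrix (Fin d) (Fin d) ℝ) : Continuous (normM M) := by
  unfold normM
  fun_prop

theorem continuous_normM_sub (M : Matrix (Fin d) (Fin d) ℝ) :
    Continuous fun p : EuclideanSpace ℝ (Fin d) × EuclideanSpace ℝ (Fin d) =>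
      normM M (p.1 - p.2) :=
  (continuous_normM M).comp (continuous_fst.sub continuous_snd)

theorem normM_nonneg (M : Matrix (Fin d) (Fin d) ℝ) (x : EuclideanSpace ℝ (Fin d)) :
    0 ≤ normM M x := Real.sqrt_nonneg _

theorem IsRoot.normM_sub_comm (hA : IsRoot M A) (x y : EuclideanSpace ℝ (Fin d)) :
    normM M (x - y) = normM M (y - x) := by
  rw [hA.normM_eq, hA.normM_eq, ← norm_neg, ← map_neg, neg_sub]

theorem IsRoot.normM_pos_iff (hA : IsRoot M A) {x : EuclideanSpace ℝ (Fin d)} :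
    0 < normM M x ↔ x ≠ 0 := by
  rw [hA.normM_eq, hA.norm_pos_iff]

/-! ### Couplings and Wasserstein distances. -/

section Wasserstein

theorem isProbabilityMeasure_of_mem_couplings {ν μ : Measure (EuclideanSpace ℝ (Fin d))}
    [hν : IsProbabilityMeasure ν]
    {π : Measure (EuclideanSpace ℝ (Fin d) × EuclideanSpace ℝ (Fin d))} (hπ : π ∈ couplings ν μ) :
    IsProbabilityMeasure π := by
  rw [← hπ.1] at hν
  exact Measure.isProbabilityMeasure_of_map Prod.fst

theorem wasserstein_mono {ν μ : Measure (EuclideanSpace ℝ (Fin d))}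
    [IsProbabilityMeasure ν] {r s : ℝ≥0∞} (hrs : r ≤ s) :
    wasserstein M r ν μ ≤ wasserstein M s ν μ := by
  refine iInf₂_mono fun π hπ => ?_
  have := isProbabilityMeasure_of_mem_couplings hπ
  exact eLpNorm_le_eLpNorm_of_exponent_le hrs (continuous_normM_sub M).aestronglyMeasurable

theorem wasserstein_dirac_le (M : Matrix (Fin d) (Fin d) ℝ) {r : ℝ≥0∞} (hr : r ≠ 0)
    (z y : EuclideanSpace ℝ (Fin d)) :
    wasserstein M r (.dirac z) (.dirac y) ≤ ENNReal.ofReal (normM M (z - y)) := by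
  have h : Measure.dirac (z, y) ∈ couplings (.dirac z) (.dirac y) :=
    ⟨Measure.map_dirac' measurable_fst _, Measure.map_dirac' measurable_snd _⟩
  refine (iInf₂_le _ h).trans (le_of_eq ?_)
  rw [eLpNorm_dirac _ _ hr, Real.enorm_of_nonneg (normM_nonneg _ _)]

/-- The easy half of the Kantorovich duality. -/
theorem ofReal_abs_integral_sub_le {f : EuclideanSpace ℝ (Fin d) → ℝ} (hfc : Continuous f)
    {C : ℝ} (hC : ∀ z, |f z| ≤ C) {L : ℝ≥0∞} (hL : L ≠ ∞)
    (hf : ∀ z y, ENNReal.ofReal |f z - f y| ≤ L * ENNReal.ofReal (normM M (z - y)))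
    (ν μ : Measure (EuclideanSpace ℝ (Fin d))) [IsProbabilityMeasure ν] [IsProbabilityMeasure μ] :
    ENNReal.ofReal |∫ x, f x ∂ν - ∫ x, f x ∂μ| ≤ L * wasserstein M 1 ν μ := by
  -- The product coupling matters when `L = 0`: an infimum over no couplings would be `∞`, and the
  -- factor could not be moved inside.
  have : Nonempty (couplings ν μ) := ⟨ν.prod μ, by simp, by simp⟩
  rw [wasserstein, iInf_subtype', ENNReal.mul_iInf (by simp [hL])]
  refine le_iInf fun ⟨π, hπ⟩ => ?_
  have := isProbabilityMeasure_of_mem_couplings hπ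
  have hi : ∀ g : EuclideanSpace ℝ (Fin d) × EuclideanSpace ℝ (Fin d) → EuclideanSpace ℝ (Fin d),
      Continuous g → Integrable (fun p => f (g p)) π := fun g hg =>
    .of_bound (hfc.comp hg).aestronglyMeasurable C (ae_of_all _ fun p => hC _)
  have e : ∫ x, f x ∂ν - ∫ x, f x ∂μ = ∫ p, (f p.1 - f p.2) ∂π := by
    rw [integral_sub (hi _ continuous_fst) (hi _ continuous_snd), ← hπ.1, ← hπ.2,
      integral_map measurable_fst.aemeasurable hfc.aestronglyMeasurable,
      integral_map measurable_snd.aemeasurable hfc.aestronglyMeasurable]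
  rw [e, ← Real.enorm_eq_ofReal_abs, eLpNorm_one_eq_lintegral_enorm, ← lintegral_const_mul' _ _ hL]
  refine (enorm_integral_le_lintegral_enorm _).trans (lintegral_mono fun p => ?_)
  rw [Real.enorm_eq_ofReal_abs, Real.enorm_of_nonneg (normM_nonneg _ _)]
  exact hf _ _

end Wasserstein

/-! ### Local and global Lipschitz constants. -/

section Slope

theorem slopeM_le_iff (f : EuclideanSpace ℝ (Fin d) → ℝ) {z y : EuclideanSpace ℝ (Fin d)}
    (h : 0 < normM M (y - z)) {L : ℝ≥0∞} :
    slopeM M f z y ≤ L ↔ ENNReal.ofReal |f z - f y| ≤ L * ENNReal.ofReal (normM M (y - z)) := by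
  rw [slopeM, ENNReal.ofReal_div_of_pos h, ENNReal.div_le_iff (by simpa using h) (by simp)]

/-- Clearing the denominator makes the diagonal harmless, since both sides vanish there. -/
theorem IsRoot.gradNormSup_le_iff (hA : IsRoot M A) (f : EuclideanSpace ℝ (Fin d) → ℝ)
    {L : ℝ≥0∞} : gradNormSup M f ≤ L ↔
      ∀ z y, ENNReal.ofReal |f z - f y| ≤ L * ENNReal.ofReal (normM M (z - y)) := by
  simp only [gradNormSup, iSup_le_iff]
  refine forall₂_congr fun z y => ?_
  rcases eq_or_ne z y with rfl | hne
  · simp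
  · rw [hA.normM_sub_comm z y, ← slopeM_le_iff f (hA.normM_pos_iff.2 (sub_ne_zero.2 hne.symm))]
    simp [hne]

theorem IsRoot.gradNormSup_ne_top (hA : IsRoot M A) {f : EuclideanSpace ℝ (Fin d) → ℝ} {K : ℝ≥0}
    (hf : LipschitzWith K f) : gradNormSup M f ≠ ∞ := by
  obtain ⟨c, hc, h⟩ := hA.exists_norm_le
  refine ne_top_of_le_ne_top (ENNReal.ofReal_ne_top (r := K * c))
    ((hA.gradNormSup_le_iff f).2 fun z y => ?_)
  rw [← ENNReal.ofReal_mul (by positivity)]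
  refine ENNReal.ofReal_le_ofReal ?_
  calc |f z - f y| ≤ K * ‖z - y‖ := by simpa [Real.dist_eq, dist_eq_norm] using hf.dist_le_mul z y
    _ ≤ K * (c * ‖A (z - y)‖) := by gcongr; exact h _
    _ = K * c * normM M (z - y) := by rw [hA.normM_eq]; ring

/-- The supremum of the slopes of `f` at `z` at scale `r`. -/
noncomputable def localSlope (M : Matrix (Fin d) (Fin d) ℝ) (f : EuclideanSpace ℝ (Fin d) → ℝ)
    (r : ℝ) (z : EuclideanSpace ℝ (Fin d)) : ℝ≥0∞ :=
  ⨆ (y : EuclideanSpace ℝ (Fin d)) (_ : 0 < normM M (z - y) ∧ normM M (z - y) ≤ r), slopeM M f z y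

theorem localSlope_mono (M : Matrix (Fin d) (Fin d) ℝ) (f : EuclideanSpace ℝ (Fin d) → ℝ)
    {r s : ℝ} (h : r ≤ s) (z : EuclideanSpace ℝ (Fin d)) :
    localSlope M f r z ≤ localSlope M f s z :=
  iSup_mono fun _ => iSup_mono' fun hy => ⟨⟨hy.1, hy.2.trans h⟩, le_rfl⟩

theorem gradNorm_le_localSlope (M : Matrix (Fin d) (Fin d) ℝ)
    (f : EuclideanSpace ℝ (Fin d) → ℝ) {r : ℝ} (hr : 0 < r) (z : EuclideanSpace ℝ (Fin d)) :
    gradNorm M f z ≤ localSlope M f r z := iInf₂_le r hr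

theorem IsRoot.localSlope_le_gradNormSup (hA : IsRoot M A) (f : EuclideanSpace ℝ (Fin d) → ℝ)
    (r : ℝ) (z : EuclideanSpace ℝ (Fin d)) : localSlope M f r z ≤ gradNormSup M f :=
  iSup₂_le fun y hy => le_iSup_of_le z (le_iSup₂_of_le y
    (sub_ne_zero.1 (hA.normM_pos_iff.1 hy.1)) le_rfl)

/-- A countable family of radii is needed for measurability and for monotone convergence. -/
theorem gradNorm_eq_iInf_nat (M : Matrix (Fin d) (Fin d) ℝ) (f : EuclideanSpace ℝ (Fin d) → ℝ)
    (z : EuclideanSpace ℝ (Fin d)) : gradNorm M f z = ⨅ n : ℕ, localSlope M f (1 / (n + 1)) z := by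
  refine le_antisymm (le_iInf fun n => gradNorm_le_localSlope M f Nat.one_div_pos_of_nat z)
    (le_iInf₂ fun r hr => ?_)
  obtain ⟨n, hn⟩ := exists_nat_one_div_lt hr
  exact (iInf_le _ n).trans (localSlope_mono M f hn.le z)

/-- After the substitution `y = z + h` the constraint no longer involves `z`. What remains is a
supremum of continuous functions of `z`, hence lower semicontinuous. -/
theorem IsRoot.measurable_localSlope (hA : IsRoot M A) {f : EuclideanSpace ℝ (Fin d) → ℝ}
    (hf : Continuous f) (r : ℝ) : Measurable (localSlope M f r) := by
  have e : localSlope M f r = fun z => ⨆ (h : EuclideanSpace ℝ (Fin d))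
      (_ : 0 < normM M h ∧ normM M h ≤ r), ENNReal.ofReal (|f z - f (z + h)| / normM M h) := by
    funext z
    refine le_antisymm (iSup₂_le fun y hy => ?_) (iSup₂_le fun h hh => ?_)
    · rw [hA.normM_sub_comm] at hy
      refine le_iSup₂_of_le (y - z) hy ?_
      simp [slopeM]
    · refine le_iSup₂_of_le (z + h) ?_ ?_
      · rw [hA.normM_sub_comm]
        simpa using hh
      · simp [slopeM]
  rw [e]
  refine (lowerSemicontinuous_iSup fun h => lowerSemicontinuous_iSup fun _ =>
    (ENNReal.continuous_ofReal.comp ?_).lowerSemicontinuous).measurable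
  fun_prop

/-- A function whose local Lipschitz constants are bounded by `L` has Lipschitz constant `L`. -/
theorem IsRoot.gradNormSup_le_of_gradNorm_le (hA : IsRoot M A)
    {f : EuclideanSpace ℝ (Fin d) → ℝ} {L : ℝ≥0∞} (h : ∀ z, gradNorm M f z ≤ L) :
    gradNormSup M f ≤ L := by
  rcases eq_or_ne L ∞ with rfl | hL
  · exact le_top
  lift L to ℝ≥0 using hL
  have hloc : ∀ z, ∀ L' : ℝ, L < L' → ∀ᶠ y in 𝓝 z, |f z - f y| ≤ L' * normM M (y - z) := by
    intro z L' hL'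
    have h1 : gradNorm M f z < ENNReal.ofReal L' := (h z).trans_lt
      (by rwa [ENNReal.lt_ofReal_iff_toReal_lt (by simp)])
    simp only [gradNorm, iInf_lt_iff] at h1
    obtain ⟨r, hr, h1⟩ := h1
    have hev : ∀ᶠ y in 𝓝 z, normM M (z - y) < r := by
      have hc : Continuous fun y => normM M (z - y) :=
        (continuous_normM M).comp (continuous_const.sub continuous_id)
      refine hc.continuousAt.eventually_lt continuousAt_const ?_
      simpa [normM] using hr
    filter_upwards [hev] with y hy
    rcases eq_or_ne z y with rfl | hne
    · simp [normM]
    have hp : 0 < normM M (z - y) := hA.normM_pos_iff.2 (sub_ne_zero.2 hne)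
    have h2 := (le_iSup₂ (f := fun (y : EuclideanSpace ℝ (Fin d))
      (_ : 0 < normM M (z - y) ∧ normM M (z - y) ≤ r) => slopeM M f z y) y ⟨hp, hy.le⟩).trans h1.le
    rw [hA.normM_sub_comm] at hp
    rw [slopeM, ENNReal.ofReal_le_ofReal_iff (L.2.trans hL'.le), div_le_iff₀ hp] at h2
    exact h2
  -- Continuity is not assumed; it follows from the local bounds with `L' = L + 1`.
  have hcont : Continuous f := by
    refine continuous_iff_continuousAt.2 fun z => ?_
    rw [ContinuousAt, tendsto_iff_norm_sub_tendsto_zero]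
    have hlim : Tendsto (fun y => (L + 1 : ℝ) * normM M (y - z)) (𝓝 z) (𝓝 0) := by
      have hc : Continuous fun y => (L + 1 : ℝ) * normM M (y - z) :=
        continuous_const.mul ((continuous_normM M).comp (continuous_id.sub continuous_const))
      simpa [normM] using hc.tendsto z
    refine squeeze_zero' (Eventually.of_forall fun _ => norm_nonneg _) ?_ hlim
    filter_upwards [hloc z (L + 1) (lt_add_one _)] with y hy
    rwa [norm_sub_rev]
  have hle : ∀ z y, f y ≤ f z + L * normM M (y - z) := by
    intro z y
    rcases eq_or_ne y z with rfl | hne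
    · simp [normM]
    set N := normM M (y - z) with hN
    have hNpos : 0 < N := hA.normM_pos_iff.2 (sub_ne_zero.2 hne)
    have hγ : Continuous fun θ : ℝ => z + θ • (y - z) := by fun_prop
    -- Along the segment, `f` is compared with the line of slope `L * N`. The comparison uses only
    -- lower right slopes, so `f` need not be differentiable.
    have := image_le_of_liminf_slope_right_le_deriv_boundary (a := 0) (b := 1)
      (f := fun θ : ℝ => f (z + θ • (y - z))) (B := fun θ => f z + θ * (L * N))
      (B' := fun _ => L * N) (hcont.comp hγ).continuousOn (by simp)
      (by fun_prop) (fun θ _ => by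
        simpa using (((hasDerivAt_id θ).mul_const (L * N)).const_add (f z)).hasDerivWithinAt)
      (fun θ _ r hr => by
        obtain ⟨L', h1, h2⟩ := exists_between ((lt_div_iff₀ hNpos).2 hr)
        have hev : ∀ᶠ θ' in 𝓝[>] θ, |f (z + θ • (y - z)) - f (z + θ' • (y - z))|
            ≤ L' * normM M ((z + θ' • (y - z)) - (z + θ • (y - z))) :=
          (hγ.continuousAt.tendsto.mono_left nhdsWithin_le_nhds).eventually (hloc _ L' h1)
        refine (hev.and self_mem_nhdsWithin).frequently.mono fun θ' ⟨h3, h4⟩ => ?_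
        have h5 : 0 < θ' - θ := sub_pos.2 h4
        rw [slope_def_field, div_lt_iff₀ h5]
        have e : (z + θ' • (y - z)) - (z + θ • (y - z)) = (θ' - θ) • (y - z) := by module
        rw [e, hA.normM_eq, map_smul, norm_smul, ← hA.normM_eq, ← hN,
          Real.norm_of_nonneg h5.le, abs_sub_comm] at h3
        rw [lt_div_iff₀ hNpos] at h2
        nlinarith [le_abs_self (f (z + θ' • (y - z)) - f (z + θ • (y - z)))])
      (right_mem_Icc.2 zero_le_one)
    simpa using this
  rw [hA.gradNormSup_le_iff]
  intro z y
  rw [← ENNReal.ofReal_coe_nnreal, ← ENNReal.ofReal_mul L.coe_nonneg]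
  refine ENNReal.ofReal_le_ofReal (abs_sub_le_iff.2 ⟨?_, ?_⟩)
  · linarith [hle y z]
  · rw [hA.normM_sub_comm]
    linarith [hle z y]

end Slope

end

/-! ### From pathwise contraction to Wasserstein and gradient bounds. -/

section

variable {Ω : Type*} [MeasurableSpace Ω] {P : Measure Ω} [IsProbabilityMeasure P] {d : ℕ}
  {M : Matrix (Fin d) (Fin d) ℝ} {A : EuclideanSpace ℝ (Fin d) →L[ℝ] EuclideanSpace ℝ (Fin d)}
  {b : EuclideanSpace ℝ (Fin d) → EuclideanSpace ℝ (Fin d)}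
  {S : Matrix (Fin d) (Fin d) ℝ} {W : ℝ≥0 → Ω → EuclideanSpace ℝ (Fin d)}
  {Φ : EuclideanSpace ℝ (Fin d) → ℝ≥0 → Ω → EuclideanSpace ℝ (Fin d)} {K : ℝ≥0} {t : ℝ≥0} {c : ℝ}

/-- By Fubini, starting the flow at a random point independent of the noise realises `ν P_t`. Taking
for `g` the two projections of a coupling identifies both marginals of the common-noise coupling. -/
theorem IsFlow.map_prod_eq_evolve (hΦ : IsFlow b S W P Φ) (hb : LipschitzWith K b) (t : ℝ≥0)
    {α : Type*} [MeasurableSpace α] (π : Measure α) [SFinite π] {g : α → EuclideanSpace ℝ (Fin d)}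
    (hg : Measurable g) :
    (π.prod P).map (fun q => Φ (g q.1) t q.2) = evolve b S W P t (π.map g) := by
  have hm : Measurable fun q : α × Ω => Φ (g q.1) t q.2 :=
    (hΦ.measurable_uncurry hb t).comp ((hg.comp measurable_fst).prodMk measurable_snd)
  have hT := hΦ.measurable_transition hb t
  ext s hs
  rw [Measure.map_apply hm hs, Measure.prod_apply (hm hs), evolve,
    Measure.bind_apply hs hT.aemeasurable,
    lintegral_map (f := fun z => transition b S W P t z s) ((Measure.measurable_coe hs).comp hT) hg]
  refine lintegral_congr fun a => ?_
  rw [hΦ.transition_eq hb, Measure.map_apply (hΦ.measurable _ t) hs]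
  rfl

/-- Almost sure contraction of the flow implies contraction of all Wasserstein distances. -/
theorem IsFlow.wasserstein_evolve_le (hΦ : IsFlow b S W P Φ) (hb : LipschitzWith K b)
    (h : ∀ z y, ∀ᵐ ω ∂P, normM M (Φ z t ω - Φ y t ω) ≤ c * normM M (z - y)) (r : ℝ≥0∞)
    (ν μ : Measure (EuclideanSpace ℝ (Fin d))) [IsProbabilityMeasure ν] [IsProbabilityMeasure μ] :
    wasserstein M r (evolve b S W P t ν) (evolve b S W P t μ)
      ≤ ENNReal.ofReal c * wasserstein M r ν μ := by
  have : Nonempty (couplings ν μ) := ⟨ν.prod μ, by simp, by simp⟩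
  conv_rhs => rw [wasserstein, iInf_subtype', ENNReal.mul_iInf (by simp)]
  refine le_iInf fun ⟨π, hπ⟩ => ?_
  have := isProbabilityMeasure_of_mem_couplings hπ
  have hm : ∀ g : EuclideanSpace ℝ (Fin d) × EuclideanSpace ℝ (Fin d) → EuclideanSpace ℝ (Fin d),
      Measurable g → Measurable fun q : _ × Ω => Φ (g q.1) t q.2 := fun g hg =>
    (hΦ.measurable_uncurry hb t).comp ((hg.comp measurable_fst).prodMk measurable_snd)
  have h1 := hm _ measurable_fst
  have h2 := hm _ measurable_snd
  have hcoup : (π.prod P).map (fun q => (Φ q.1.1 t q.2, Φ q.1.2 t q.2))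
      ∈ couplings (evolve b S W P t ν) (evolve b S W P t μ) := by
    constructor
    · rw [Measure.map_map measurable_fst (h1.prodMk h2), ← hπ.1,
        ← hΦ.map_prod_eq_evolve hb t π measurable_fst]
      rfl
    · rw [Measure.map_map measurable_snd (h1.prodMk h2), ← hπ.2,
        ← hΦ.map_prod_eq_evolve hb t π measurable_snd]
      rfl
  refine (iInf₂_le _ hcoup).trans ?_
  have hN := continuous_normM_sub M
  rw [eLpNorm_map_measure hN.aestronglyMeasurable (h1.prodMk h2).aemeasurable]
  have hfst : eLpNorm (fun p => normM M (p.1 - p.2)) r π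
      = eLpNorm ((fun p => normM M (p.1 - p.2)) ∘ Prod.fst) r (π.prod P) := by
    rw [← eLpNorm_map_measure hN.aestronglyMeasurable measurable_fst.aemeasurable,
      Measure.map_fst_prod]
    simp
  rw [hfst]
  refine eLpNorm_le_mul_eLpNorm_of_ae_le_mul ?_ r
  simp only [Function.comp_apply, Real.norm_of_nonneg (normM_nonneg _ _)]
  rw [Measure.ae_prod_iff_ae_ae]
  · exact ae_of_all _ fun p => h p.1 p.2
  · exact measurableSet_le (hN.measurable.comp (h1.prodMk h2))
      (((hN.measurable.comp measurable_fst)).const_mul c)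

/-- Almost sure contraction of the flow implies the pointwise gradient bound. -/
theorem IsFlow.gradNorm_semigroup_le (hΦ : IsFlow b S W P Φ) (hb : LipschitzWith K b)
    (hA : IsRoot M A) (hc : 0 < c)
    (h : ∀ z y, ∀ᵐ ω ∂P, normM M (Φ z t ω - Φ y t ω) ≤ c * normM M (z - y))
    {f : EuclideanSpace ℝ (Fin d) → ℝ} (hf : IsBoundedLipschitz f) (z : EuclideanSpace ℝ (Fin d)) :
    gradNorm M (semigroup b S W P t f) z
      ≤ ENNReal.ofReal c * semigroupENN b S W P t (gradNorm M f) z := by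
  obtain ⟨⟨C, hC⟩, κ, hκ⟩ := hf
  have hmeas : ∀ n : ℕ, Measurable (localSlope M f (1 / (n + 1))) := fun n =>
    hA.measurable_localSlope hκ.continuous _
  have hgrad : gradNorm M f = fun z => ⨅ n : ℕ, localSlope M f (1 / (n + 1)) z :=
    funext (gradNorm_eq_iInf_nat M f)
  have hanti : Antitone fun n : ℕ => localSlope M f (1 / (n + 1 : ℝ)) := fun m n hmn x =>
    localSlope_mono M f (Nat.one_div_le_one_div hmn) x
  -- Monotone convergence for a decreasing sequence needs a finite integral to start from; the
  -- global Lipschitz constant provides it.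
  rw [hΦ.semigroupENN_eq hb t (by rw [hgrad]; exact .iInf hmeas), hgrad,
    lintegral_iInf (f := fun n ω => localSlope M f (1 / (n + 1)) (Φ z t ω))
      (fun n => (hmeas n).comp (hΦ.measurable z t))
      (fun m n hmn ω => hanti hmn _) (ne_top_of_le_ne_top (b := gradNormSup M f)
        (hA.gradNormSup_ne_top hκ) ?_), ENNReal.mul_iInf (by simp)]
  · refine le_iInf fun n => ?_
    have hn : (0 : ℝ) < 1 / (n + 1) := Nat.one_div_pos_of_nat
    -- The radius `1 / (n + 1) / c` at time 0 becomes at most `1 / (n + 1)` at time `t`, so the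
    -- slope of `f` between the two solutions counts in `localSlope` at that scale.
    refine (gradNorm_le_localSlope M _ (div_pos hn hc) z).trans (iSup₂_le fun y hy => ?_)
    have hy1 := hy.1
    rw [hA.normM_sub_comm] at hy1
    rw [slopeM_le_iff _ hy1, hΦ.semigroup_eq hb t hκ.continuous,
      hΦ.semigroup_eq hb t hκ.continuous]
    have hi : ∀ x, Integrable (fun ω => f (Φ x t ω)) P := fun x =>
      .of_bound (hκ.continuous.measurable.comp (hΦ.measurable x t)).aestronglyMeasurable C
        (ae_of_all _ fun p => hC _)
    rw [← integral_sub (hi z) (hi y), ← Real.enorm_eq_ofReal_abs, mul_right_comm,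
      ← lintegral_const_mul' _ _ (by finiteness)]
    refine (enorm_integral_le_lintegral_enorm _).trans (lintegral_mono_ae ?_)
    filter_upwards [h z y] with ω hω
    rcases eq_or_ne (Φ z t ω) (Φ y t ω) with he | hne
    · simp [he]
    have hp : 0 < normM M (Φ z t ω - Φ y t ω) := hA.normM_pos_iff.2 (sub_ne_zero.2 hne)
    have hr : normM M (Φ z t ω - Φ y t ω) ≤ 1 / (n + 1) := by
      have := (le_div_iff₀ hc).1 hy.2
      linarith
    have h3 : slopeM M f (Φ z t ω) (Φ y t ω) ≤ localSlope M f (1 / (n + 1)) (Φ z t ω) :=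
      le_iSup₂_of_le (Φ y t ω) ⟨hp, hr⟩ le_rfl
    have hp' := hp
    rw [hA.normM_sub_comm] at hp'
    rw [slopeM_le_iff f hp', hA.normM_sub_comm] at h3
    rw [Real.enorm_eq_ofReal_abs, mul_comm, hA.normM_sub_comm y z, ← ENNReal.ofReal_mul hc.le]
    exact h3.trans (by gcongr)
  · calc _ ≤ ∫⁻ _, gradNormSup M f ∂P :=
          lintegral_mono fun ω => hA.localSlope_le_gradNormSup f _ _
      _ ≤ gradNormSup M f := by simp

/-- The pointwise gradient bound implies the uniform one. -/
theorem IsFlow.gradNormSup_semigroup_le_of_gradNorm (hΦ : IsFlow b S W P Φ)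
    (hb : LipschitzWith K b) (hA : IsRoot M A) {f : EuclideanSpace ℝ (Fin d) → ℝ}
    (h : ∀ z, gradNorm M (semigroup b S W P t f) z
      ≤ ENNReal.ofReal c * semigroupENN b S W P t (gradNorm M f) z) :
    gradNormSup M (semigroup b S W P t f) ≤ ENNReal.ofReal c * gradNormSup M f := by
  refine hA.gradNormSup_le_of_gradNorm_le fun z => (h z).trans ?_
  gcongr
  have := hΦ.isProbabilityMeasure_transition hb t z
  calc semigroupENN b S W P t (gradNorm M f) z
      ≤ ∫⁻ _, gradNormSup M f ∂(transition b S W P t z) := lintegral_mono fun y =>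
        (gradNorm_le_localSlope M f one_pos y).trans (hA.localSlope_le_gradNormSup f 1 y)
    _ = gradNormSup M f := by simp

/-- Contraction of the Wasserstein distance of order one between the transition probabilities
implies the bound on the Lipschitz constant. -/
theorem IsFlow.gradNormSup_semigroup_le_of_wasserstein (hΦ : IsFlow b S W P Φ)
    (hb : LipschitzWith K b) (hA : IsRoot M A) {r : ℝ≥0∞} (hr : 1 ≤ r)
    (h : ∀ (ν μ : Measure (EuclideanSpace ℝ (Fin d))) [IsProbabilityMeasure ν]
      [IsProbabilityMeasure μ], wasserstein M r (evolve b S W P t ν) (evolve b S W P t μ)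
        ≤ ENNReal.ofReal c * wasserstein M r ν μ)
    {f : EuclideanSpace ℝ (Fin d) → ℝ} (hf : IsBoundedLipschitz f) :
    gradNormSup M (semigroup b S W P t f) ≤ ENNReal.ofReal c * gradNormSup M f := by
  obtain ⟨⟨C, hC⟩, κ, hκ⟩ := hf
  rw [hA.gradNormSup_le_iff]
  intro z y
  have hz := hΦ.isProbabilityMeasure_transition hb t z
  have hy := hΦ.isProbabilityMeasure_transition hb t y
  have hT := hΦ.measurable_transition hb t
  have h1 := h (.dirac z) (.dirac y)
  simp only [evolve, Measure.dirac_bind hT] at h1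
  have hr0 : r ≠ 0 := (one_pos.trans_le hr).ne'
  calc _ ≤ gradNormSup M f * wasserstein M 1 (transition b S W P t z) (transition b S W P t y) :=
        ofReal_abs_integral_sub_le hκ.continuous hC (hA.gradNormSup_ne_top hκ)
          ((hA.gradNormSup_le_iff f).1 le_rfl) _ _
    _ ≤ gradNormSup M f * (ENNReal.ofReal c * ENNReal.ofReal (normM M (z - y))) := by
        gcongr
        exact (wasserstein_mono hr).trans (h1.trans (by
          gcongr
          exact wasserstein_dirac_le M hr0 z y))
    _ = _ := by ring

/-! ### From the Lipschitz bound back to the drift. -/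

theorem abs_clamp_sub_clamp_le (R a b : ℝ) :
    |max (min a R) (-R) - max (min b R) (-R)| ≤ |a - b| :=
  (abs_max_sub_max_le_abs _ _ _).trans (abs_inf_sub_inf_le_abs _ _ _)

/-- The bound on the Lipschitz constant, applied to truncated linear functions. -/
theorem IsFlow.integral_inner_sub_le (hΦ : IsFlow b S W P Φ) (hb : LipschitzWith K b)
    (hA : IsRoot M A) (hc : 0 < c)
    (h : ∀ f, IsBoundedLipschitz f →
      gradNormSup M (semigroup b S W P t f) ≤ ENNReal.ofReal c * gradNormSup M f)
    (p z y : EuclideanSpace ℝ (Fin d)) :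
    ∫ ω, ⟪p, A (Φ z t ω - Φ y t ω)⟫_ℝ ∂P ≤ c * ‖p‖ * ‖A (z - y)‖ := by
  -- Clamping makes the linear function bounded without raising its Lipschitz constant `‖p‖`.
  let f : ℕ → EuclideanSpace ℝ (Fin d) → ℝ := fun n x => max (min ⟪p, A x⟫_ℝ n) (-n)
  have hsub : ∀ n x x', |f n x - f n x'| ≤ ‖p‖ * ‖A (x - x')‖ := fun n x x' =>
    (abs_clamp_sub_clamp_le _ _ _).trans (by
      rw [← inner_sub_right, ← map_sub]
      exact abs_real_inner_le_norm _ _)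
  have hbd : ∀ n x, |f n x| ≤ n := fun n x => abs_le.2
    ⟨le_max_right _ _, max_le (min_le_right _ _) (by simp)⟩
  have hBL : ∀ n, IsBoundedLipschitz (f n) := fun n => by
    refine ⟨⟨n, hbd n⟩, ‖p‖₊ * ‖A‖₊, LipschitzWith.of_dist_le_mul fun x x' => ?_⟩
    rw [Real.dist_eq, dist_eq_norm, NNReal.coe_mul, mul_assoc]
    exact (hsub n x x').trans (mul_le_mul_of_nonneg_left (A.le_opNorm _) (norm_nonneg _))
  have hcont : ∀ n, Continuous (f n) := fun n => (hBL n).2.choose_spec.continuous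
  have hi : ∀ n x, Integrable (fun ω => f n (Φ x t ω)) P := fun n x =>
    .of_bound ((hcont n).measurable.comp (hΦ.measurable x t)).aestronglyMeasurable n
      (ae_of_all _ fun _ => hbd n _)
  have hle : ∀ n, ∫ ω, (f n (Φ z t ω) - f n (Φ y t ω)) ∂P ≤ c * ‖p‖ * ‖A (z - y)‖ := fun n => by
    have h1 : gradNormSup M (f n) ≤ ENNReal.ofReal ‖p‖ := by
      rw [hA.gradNormSup_le_iff]
      intro x x'
      rw [← ENNReal.ofReal_mul (norm_nonneg _), hA.normM_eq]
      exact ENNReal.ofReal_le_ofReal (hsub n x x')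
    have h2 : gradNormSup M (semigroup b S W P t (f n)) ≤ ENNReal.ofReal (c * ‖p‖) := by
      rw [ENNReal.ofReal_mul hc.le]
      exact (h _ (hBL n)).trans (by gcongr)
    have h3 := (hA.gradNormSup_le_iff _).1 h2 z y
    rw [← ENNReal.ofReal_mul (by positivity), hA.normM_eq,
      ENNReal.ofReal_le_ofReal_iff (by positivity), hΦ.semigroup_eq hb t (hcont n),
      hΦ.semigroup_eq hb t (hcont n), ← integral_sub (hi n z) (hi n y)] at h3
    exact (le_abs_self _).trans h3
  -- The Grönwall bound on the flow is uniform in `ω`, so a constant dominates and no moments of the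
  -- solutions are needed.
  refine le_of_tendsto' (tendsto_integral_of_dominated_convergence
    (fun _ => ‖p‖ * (‖A‖ * (Real.exp (K * t) * ‖z - y‖)))
    (fun n => ((hi n z).sub (hi n y)).aestronglyMeasurable) (integrable_const _)
    (fun n => ae_of_all _ fun ω => ?_) (ae_of_all _ fun ω => ?_)) hle
  · refine (hsub n _ _).trans ?_
    gcongr
    exact (A.le_opNorm _).trans (by gcongr; exact hΦ.norm_sub_le hb z y t ω)
  · rw [map_sub, inner_sub_right]
    have hlim : ∀ x, Tendsto (fun n => f n x) atTop (𝓝 ⟪p, A x⟫_ℝ) := fun x => by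
      obtain ⟨N, hN⟩ := exists_nat_ge |⟪p, A x⟫_ℝ|
      refine tendsto_const_nhds.congr' ?_
      filter_upwards [eventually_ge_atTop N] with n hn
      have h1 : |⟪p, A x⟫_ℝ| ≤ n := hN.trans (by exact_mod_cast hn)
      have h2 := abs_le.1 h1
      simp only [f]
      rw [min_eq_left h2.2, max_eq_left h2.1]
    exact (hlim _).sub (hlim _)

/-- Differentiating the contraction of the mean flow at time zero. -/
theorem IsFlow.inner_sub_le (hΦ : IsFlow b S W P Φ) (hb : LipschitzWith K b) {ρ : ℝ}
    (h : ∀ (t : ℝ≥0) (p z y : EuclideanSpace ℝ (Fin d)),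
      ∫ ω, ⟪p, A (Φ z t ω - Φ y t ω)⟫_ℝ ∂P ≤ Real.exp (-ρ * t) * ‖p‖ * ‖A (z - y)‖)
    (z y : EuclideanSpace ℝ (Fin d)) :
    ⟪A (z - y), A (b z - b y)⟫_ℝ ≤ -ρ * ‖A (z - y)‖ ^ 2 := by
  set p := A (z - y) with hp
  have hB : HasDerivAt (fun s : ℝ => Real.exp (-ρ * s) * ‖p‖ ^ 2) (-ρ * ‖p‖ ^ 2) 0 := by
    simpa using (((hasDerivAt_id (0 : ℝ)).const_mul (-ρ)).exp).mul_const (‖p‖ ^ 2)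
  have hright : 𝓝[>] (0 : ℝ) ≤ 𝓝[≠] 0 := nhdsWithin_mono 0 fun θ (hθ : 0 < θ) => hθ.ne'
  obtain ⟨V, -, hV⟩ := hΦ.isPathSolution
  let g : Ω → ℝ → ℝ := fun ω s => ⟪p, A (Φ z s.toNNReal ω - Φ y s.toNNReal ω)⟫_ℝ
  have hg0 : ∀ ω, g ω 0 = ‖p‖ ^ 2 := fun ω => by
    simp only [g, Real.toNNReal_zero, hΦ.zero, ← hp, real_inner_self_eq_norm_sq]
  -- At time 0 the flow sits at `z` and `y` for every `ω`, so this derivative is deterministic.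
  have hgd : ∀ ω, HasDerivWithinAt (g ω) ⟪p, A (b z - b y)⟫_ℝ (Ici 0) 0 := fun ω => by
    have h1 := (hV z ω).hasDerivWithinAt_sub hb.continuous (hV y ω) le_rfl
    simp only [Real.toNNReal_zero, hΦ.zero] at h1
    exact (innerSL ℝ p).hasFDerivAt.comp_hasDerivWithinAt 0
      (A.hasFDerivAt.comp_hasDerivWithinAt 0 h1)
  have hgm : ∀ s, Measurable fun ω => g ω s := fun s => by
    have h1 : Continuous fun x => ⟪p, A x⟫_ℝ := by fun_prop
    exact h1.measurable.comp ((hΦ.measurable z _).sub (hΦ.measurable y _))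
  have hsub : ∀ ω, ∀ s ∈ Ioc (0 : ℝ) 1, |g ω s - g ω 0|
      ≤ ‖p‖ * (‖A‖ * (K * (Real.exp K * ‖z - y‖) * s)) := fun ω s hs => by
    simp only [g]
    rw [← inner_sub_right, ← map_sub]
    refine (abs_real_inner_le_norm _ _).trans ?_
    gcongr
    refine (A.le_opNorm _).trans ?_
    gcongr
    have h1 := (hV z ω).sub_eq hb.continuous (hV y ω) s.toNNReal
    simp only [Real.toNNReal_zero, hΦ.zero]
    rw [h1, add_sub_cancel_left, Real.coe_toNNReal _ hs.1.le]
    refine (intervalIntegral.norm_integral_le_of_norm_le_const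
      (C := K * (Real.exp K * ‖z - y‖)) fun r hr => ?_).trans (le_of_eq ?_)
    · rw [uIoc_of_le hs.1.le] at hr
      refine (hb.norm_sub_le _ _).trans ?_
      gcongr
      refine (hΦ.norm_sub_le hb z y _ ω).trans ?_
      gcongr
      rw [Real.coe_toNNReal _ hr.1.le]
      exact mul_le_of_le_one_right K.2 (hr.2.trans hs.2)
    · rw [sub_zero, abs_of_pos hs.1]
  have hIoc : Ioc (0 : ℝ) 1 ∈ 𝓝[>] (0 : ℝ) := Ioc_mem_nhdsGT one_pos
  have hlim : Tendsto (fun s => ∫ ω, slope (g ω) 0 s ∂P) (𝓝[>] 0)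
      (𝓝 (∫ _, ⟪p, A (b z - b y)⟫_ℝ ∂P)) := by
    refine tendsto_integral_filter_of_dominated_convergence
      (fun _ => ‖p‖ * (‖A‖ * (K * (Real.exp K * ‖z - y‖)))) (Eventually.of_forall fun s => ?_) ?_
      (integrable_const _) (ae_of_all _ fun ω => ?_)
    · simp only [slope_def_field]
      exact (((hgm s).sub (hgm 0)).div_const _).aestronglyMeasurable
    · filter_upwards [hIoc] with s hs
      refine ae_of_all _ fun ω => ?_
      rw [slope_def_field, sub_zero, norm_div, Real.norm_of_nonneg hs.1.le, div_le_iff₀ hs.1]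
      exact (hsub ω s hs).trans (le_of_eq (by ring))
    · exact (hasDerivWithinAt_iff_tendsto_slope' (by simp)).1 ((hgd ω).mono Ioi_subset_Ici_self)
  rw [integral_const, probReal_univ, one_smul] at hlim
  -- Both functions of time equal `‖p‖ ^ 2` at 0, so their ordering passes to the right difference
  -- quotients.
  refine le_of_tendsto_of_tendsto hlim ((hasDerivAt_iff_tendsto_slope.1 hB).mono_left hright) ?_
  filter_upwards [hIoc] with s hs
  have hi : Integrable (fun ω => g ω s) P := by
    refine .of_bound (hgm s).aestronglyMeasurable
      (‖p‖ * (‖A‖ * (K * (Real.exp K * ‖z - y‖) * s)) + ‖p‖ ^ 2) (ae_of_all _ fun ω => ?_)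
    have h1 := hsub ω s hs
    rw [hg0] at h1
    have h2 := abs_sub_abs_le_abs_sub (g ω s) (‖p‖ ^ 2)
    rw [abs_of_nonneg (by positivity : 0 ≤ ‖p‖ ^ 2)] at h2
    rw [Real.norm_eq_abs]
    linarith
  simp only [slope_def_field, hg0]
  rw [integral_div, integral_sub hi (integrable_const _), integral_const, probReal_univ, one_smul]
  have h1 := h s.toNNReal p z y
  rw [Real.coe_toNNReal _ hs.1.le, ← hp, mul_assoc, ← sq] at h1
  have hs0 : 0 ≤ s - 0 := by simpa using hs.1.le
  simp only [mul_zero, Real.exp_zero, one_mul]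
  exact div_le_div_of_nonneg_right (sub_le_sub_right h1 _) hs0

/-- The one-sided Lipschitz condition implies its differential form. -/
theorem fderiv_inner_le_of_sub (hb : Differentiable ℝ b) {ρ : ℝ}
    (h : ∀ z y, ⟪A (z - y), A (b z - b y)⟫_ℝ ≤ -ρ * ‖A (z - y)‖ ^ 2)
    (z x : EuclideanSpace ℝ (Fin d)) :
    ⟪A x, A (fderiv ℝ b z x)⟫_ℝ ≤ -ρ * ‖A x‖ ^ 2 := by
  have h1 : HasDerivAt (fun θ : ℝ => z + θ • x) x 0 := by
    simpa using ((hasDerivAt_id (0 : ℝ)).smul_const x).const_add z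
  have h2 : HasDerivAt (fun θ : ℝ => ⟪A x, A (b (z + θ • x))⟫_ℝ) ⟪A x, A (fderiv ℝ b z x)⟫_ℝ 0 := by
    have := (hb (z + (0 : ℝ) • x)).hasFDerivAt.comp_hasDerivAt 0 h1
    rw [zero_smul, add_zero] at this
    exact (innerSL ℝ (A x)).hasFDerivAt.comp_hasDerivAt 0 (A.hasFDerivAt.comp_hasDerivAt 0 this)
  have h3 := (hasDerivAt_iff_tendsto_slope.1 h2).mono_left
    (nhdsWithin_mono 0 (fun θ (hθ : 0 < θ) => hθ.ne') : 𝓝[>] (0 : ℝ) ≤ 𝓝[≠] 0)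
  refine le_of_tendsto h3 ?_
  filter_upwards [self_mem_nhdsWithin] with θ (hθ : 0 < θ)
  -- Both sides are quadratic in the increment `θ • x`: one factor `θ` is cancelled, the other forms
  -- the difference quotient of `b`.
  have h4 := h (z + θ • x) z
  rw [add_sub_cancel_left, map_smul, inner_smul_left, norm_smul, Real.norm_of_nonneg hθ.le,
    map_sub, inner_sub_right] at h4
  simp only [conj_trivial] at h4
  rw [slope_def_field, zero_smul, add_zero, sub_zero, div_le_iff₀ hθ]
  refine le_of_mul_le_mul_left ?_ hθ
  linarith

end

end DiffusionContraction

theorem theorem1 {Ω : Type*} [MeasurableSpace Ω] (P : Measure Ω) [IsProbabilityMeasure P]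
    (d : ℕ) (W : ℝ≥0 → Ω → EuclideanSpace ℝ (Fin d)) (hW : IsBrownian W P)
    (b : EuclideanSpace ℝ (Fin d) → EuclideanSpace ℝ (Fin d)) (hb : IsAdmissibleDrift b)
    (S : Matrix (Fin d) (Fin d) ℝ) (hS : S.PosSemidef)
    (M : Matrix (Fin d) (Fin d) ℝ) (hM : M.PosDef) (ρ : ℝ) :
    List.TFAE [
      -- the deterministic condition on the drift
      ContR b M ρ,
      -- contraction of the parallel coupling
      ∀ (z₁ z₂ : EuclideanSpace ℝ (Fin d)) (Z₁ Z₂ : ℝ≥0 → Ω → EuclideanSpace ℝ (Fin d)),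
        IsSolution b S W P z₁ Z₁ → IsSolution b S W P z₂ Z₂ →
          ∀ᵐ ω ∂P, ∀ t : ℝ≥0,
            normM M (Z₁ t ω - Z₂ t ω) ≤ Real.exp (-ρ * t) * normM M (z₁ - z₂),
      -- contraction of the Wasserstein distance of infinite order
      ∀ (ν μ : Measure (EuclideanSpace ℝ (Fin d))) [IsProbabilityMeasure ν]
          [IsProbabilityMeasure μ] (t : ℝ≥0),
        wasserstein M ∞ (evolve b S W P t ν) (evolve b S W P t μ)
          ≤ ENNReal.ofReal (Real.exp (-ρ * t)) * wasserstein M ∞ ν μ,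
      -- contraction of the Wasserstein distance of order one
      ∀ (ν μ : Measure (EuclideanSpace ℝ (Fin d))) [IsProbabilityMeasure ν]
          [IsProbabilityMeasure μ] (t : ℝ≥0),
        wasserstein M 1 (evolve b S W P t ν) (evolve b S W P t μ)
          ≤ ENNReal.ofReal (Real.exp (-ρ * t)) * wasserstein M 1 ν μ,
      -- pointwise gradient bound
      ∀ f : EuclideanSpace ℝ (Fin d) → ℝ, IsBoundedLipschitz f →
        ∀ (t : ℝ≥0) (z : EuclideanSpace ℝ (Fin d)),
          gradNorm M (semigroup b S W P t f) z
            ≤ ENNReal.ofReal (Real.exp (-ρ * t)) * semigroupENN b S W P t (gradNorm M f) z,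
      -- bound on the Lipschitz constant
      ∀ f : EuclideanSpace ℝ (Fin d) → ℝ, IsBoundedLipschitz f → ∀ t : ℝ≥0,
        gradNormSup M (semigroup b S W P t f)
          ≤ ENNReal.ofReal (Real.exp (-ρ * t)) * gradNormSup M f] := by
  obtain ⟨K, hK⟩ := hb.exists_lipschitzWith
  have hd : Differentiable ℝ b := hb.smooth.differentiable (by simp)
  obtain ⟨A, hA⟩ := exists_isRoot hM
  obtain ⟨Φ, hΦ⟩ := exists_isFlow (S := S) hW hK
  -- The consequences of (ii) use it only for the measurable flow `Φ`.
  have hflow : (∀ (z₁ z₂ : EuclideanSpace ℝ (Fin d)) (Z₁ Z₂ : ℝ≥0 → Ω → EuclideanSpace ℝ (Fin d)),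
      IsSolution b S W P z₁ Z₁ → IsSolution b S W P z₂ Z₂ → ∀ᵐ ω ∂P, ∀ t : ℝ≥0,
        normM M (Z₁ t ω - Z₂ t ω) ≤ Real.exp (-ρ * t) * normM M (z₁ - z₂)) →
      ∀ (t : ℝ≥0) (z y : EuclideanSpace ℝ (Fin d)), ∀ᵐ ω ∂P,
        normM M (Φ z t ω - Φ y t ω) ≤ Real.exp (-ρ * t) * normM M (z - y) := fun h t z y => by
    filter_upwards [h z y _ _ (hΦ.isSolution z) (hΦ.isSolution y)] with ω hω using hω t
  tfae_have 1 → 2 := fun h z₁ z₂ Z₁ Z₂ h₁ h₂ => by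
    filter_upwards [h₁, h₂] with ω hω₁ hω₂ t
    rw [hA.normM_eq, hA.normM_eq]
    exact hω₁.norm_map_sub_le hd.continuous (inner_sub_le_of_fderiv hd (hA.contR_iff.1 h)) hω₂ t
  tfae_have 2 → 3 := fun h ν μ _ _ t => hΦ.wasserstein_evolve_le hK (hflow h t) ∞ ν μ
  tfae_have 2 → 4 := fun h ν μ _ _ t => hΦ.wasserstein_evolve_le hK (hflow h t) 1 ν μ
  tfae_have 2 → 5 := fun h f hf t z =>
    hΦ.gradNorm_semigroup_le hK hA (Real.exp_pos _) (hflow h t) hf z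
  tfae_have 5 → 6 := fun h f hf t => hΦ.gradNormSup_semigroup_le_of_gradNorm hK hA (h f hf t)
  tfae_have 3 → 6 := fun h f hf t =>
    hΦ.gradNormSup_semigroup_le_of_wasserstein hK hA le_top (fun ν μ _ _ => h ν μ t) hf
  tfae_have 4 → 6 := fun h f hf t =>
    hΦ.gradNormSup_semigroup_le_of_wasserstein hK hA le_rfl (fun ν μ _ _ => h ν μ t) hf
  tfae_have 6 → 1 := fun h => hA.contR_iff.2 (fderiv_inner_le_of_sub hd
    (hΦ.inner_sub_le hK fun t p z y =>
      hΦ.integral_inner_sub_le hK hA (Real.exp_pos _) (fun f hf => h f hf t) p z y))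
  tfae_finish
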